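/- For $q\in\mathbb C$ with $|q|<1$ put $(q;q)_\infty=\prod_{k\ge 1}(1-q^k)$ and $$A(q)=q^{1/5}(q;q)_\infty^{-3/5}\sum_{n=-\infty}^{\infty}(-1)^nq^{(5n^2-3n)/2},\qquad B(q)=(q;q)_\infty^{-3/5}\sum_{n=-\infty}^{\infty}(-1)^nq^{(5n^2-n)/2}.$$ (Only the fifth powers of $A$ and $B$ occur below, so the choice of the fifth roots does not matter.) For each integer $n$ define $$F_n(q)=a_{1,n}B(q)^{20}+a_{2,n}B(q)^{15}A(q)^5+a_{3,n}B(q)^{10}A(q)^{10}+a_{4,n}B(q)^5A(q)^{15}+a_{5,n}A(q)^{20},$$ where $$\begin{pmatrix}a_{1,n}\\a_{2,n}\\a_{3,n}\\a_{4,n}\\a_{5,n}\end{pmatrix}=\begin{pmatrix}1&0&0&0&0\\1356&115&10&10&-8\\1462&110&15&-110&1462\\8&10&-10&115&-1356\\0&0&0&0&1\end{pmatrix}^{n}\begin{pmatrix}1\\228\\494\\-228\\1\end{pmatrix},$$ the (invertible) matrix being taken over $\mathbb Q$. Let $\Omega_{5,0}$ be the operator on power series given by $\Omega_{5,0}\bigl(\sum_{k\ge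 0}c_kq^k\bigr)=\sum_{k\ge 0}c_{5k}q^k$, and let $\Omega_{5,0}^{(n)}$ be its $n$-fold iterate. Then, for every integer $n\ge 0$ and every $q$ with $|q|<1$, $$1+240\sum_{k=1}^{\infty}\Bigl(\sum_{d\mid 5^nk}d^3\Bigr)q^k=F_n(q),$$ where the series converges absolutely. Moreover, for every integer $n\ge 0$, the function $F_{-n}(q)$ is given by a power series in $q$ convergent for $|q|<1$, and for $|q|<1$ $$1+240\sum_{k=1}^{\infty}\Bigl(\sum_{d\mid k}d^3\Bigr)q^k=\Omega_{5,0}^{(n)}\bigl(F_{-n}\bigr)(q),$$ the right-hand side being the sum of the convergent power series obtained by applying $\Omega_{5,0}^{(n)}$ to that expansion of $F_{-n}$. -/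

import Mathlib

open scoped Matrix

noncomputable section

/-- The infinite `q`-shifted factorial `(a; q)_∞ = ∏_{k ≥ 0} (1 - a q ^ k)`, for `‖q‖ < 1`. -/
def qPochhammerInf (a q : ℂ) : ℂ := ∏' k : ℕ, (1 - a * q ^ k)

/-- The quintic theta function
`A(q) = q^{1/5} (q; q)_∞^{-3/5} ∑_{n ∈ ℤ} (-1)^n q^{(5n² - 3n)/2}`, for `‖q‖ < 1`.
Both fractional powers are principal ones. All the choices of fifth roots have the same
`A(q)^5`, namely `q (q; q)_∞^{-3} (∑ …)^5`. The integer `(5n² - 3n)/2` is exact and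
nonnegative. -/
def quinticA (q : ℂ) : ℂ :=
  q ^ (1 / 5 : ℂ) * qPochhammerInf q q ^ (-3 / 5 : ℂ) *
    ∑' n : ℤ, (-1 : ℂ) ^ n * q ^ ((5 * n ^ 2 - 3 * n) / 2)

/-- The quintic theta function
`B(q) = (q; q)_∞^{-3/5} ∑_{n ∈ ℤ} (-1)^n q^{(5n² - n)/2}`, for `‖q‖ < 1`
(principal power; `B(q)^5` does not depend on the choice of the fifth root). -/
def quinticB (q : ℂ) : ℂ :=
  qPochhammerInf q q ^ (-3 / 5 : ℂ) *
    ∑' n : ℤ, (-1 : ℂ) ^ n * q ^ ((5 * n ^ 2 - n) / 2)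

/-- The integer matrix `𝒜₄`, regarded over `ℚ` so that its negative powers make sense. -/
def quinticMatrix : Matrix (Fin 5) (Fin 5) ℚ :=
  !![1,    0,   0,   0,    0;
     1356, 115, 10,  10,   -8;
     1462, 110, 15,  -110, 1462;
     8,    10,  -10, 115,  -1356;
     0,    0,   0,   0,    1]

/-- The matrix is invertible over `ℚ`, so that its integer powers are genuine ones. -/
theorem quinticMatrix_det : quinticMatrix.det = -78125 := by
  simp [quinticMatrix, Matrix.det_succ_row_zero, Fin.sum_univ_succ, Fin.succAbove]
  norm_num

/-- The coefficient vector `(a_{1,n}, …, a_{5,n})ᵀ = 𝒜₄ⁿ (1, 228, 494, -228, 1)ᵀ`, for `n ∈ ℤ`. -/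
def quinticCoeff (n : ℤ) : Fin 5 → ℚ :=
  (quinticMatrix ^ n) *ᵥ ![1, 228, 494, -228, 1]

/-- `F_n(q) = a_{1,n} B²⁰ + a_{2,n} B¹⁵ A⁵ + a_{3,n} B¹⁰ A¹⁰ + a_{4,n} B⁵ A¹⁵ + a_{5,n} A²⁰`. -/
def quinticF (n : ℤ) (q : ℂ) : ℂ :=
  (quinticCoeff n 0 : ℂ) * quinticB q ^ 20 +
  (quinticCoeff n 1 : ℂ) * quinticB q ^ 15 * quinticA q ^ 5 +
  (quinticCoeff n 2 : ℂ) * quinticB q ^ 10 * quinticA q ^ 10 +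
  (quinticCoeff n 3 : ℂ) * quinticB q ^ 5 * quinticA q ^ 15 +
  (quinticCoeff n 4 : ℂ) * quinticA q ^ 20

/-- The multisection operator `Ω_{5,m} (∑ aₖ qᵏ) = ∑ a_{5k+m} qᵏ` on power series. -/
def multisection (m : ℕ) (f : PowerSeries ℂ) : PowerSeries ℂ :=
  PowerSeries.mk fun k => PowerSeries.coeff (5 * k + m) f

/-- `f(q) = ∑ aₖ qᵏ` in the whole open unit disc. Such a power series is unique. -/
def HasQExpansion (f : ℂ → ℂ) (P : PowerSeries ℂ) : Prop :=
  ∀ q : ℂ, ‖q‖ < 1 → HasSum (fun k : ℕ => PowerSeries.coeff k P * q ^ k) (f q)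

end

/-! Write E(q) for the Euler product, θ₁ and θ₃ for the series in B and A. Everything reduces to two
facts: F₀ is the weight-four Eisenstein series, and Ω_{5,0} sends F_n to F_{n+1}. Applying Ω_{5,0} n
times to F₀ gives the first claim, and n times to F_{-n} the second.

Both facts rest on the icosahedral group. After normalisation, the inversion τ ↦ -1/τ maps the pair
(θ₁, θ₃) to itself by a scalar times the substitution x ↦ x + ty, y ↦ tx - y, with t = (√5 - 1)/2
(`thetaConst_inversion`). Klein's vertex form (degree 12) and face form (degree 20) are invariant
under it up to a factor. Divided by η¹², they become level-one modular forms of weights 0 and 4. As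
those spaces are one-dimensional, the constant terms identify them as 1 (`vertexRatio_eq_one`) and
E₄ (`faceForm_eq_eisensteinFour`); the latter is the case n = 0.

For the recursion, put x = θ₁(q⁵) and y = qθ₃(q⁵). The triple product gives θ₁θ₃ = E(q)E(q⁵), and a
5-dissection gives x² - xy - y² for the same product. With the vertex identity these determine B⁵A⁵
and B¹⁰ - 11B⁵A⁵ - A¹⁰, and hence show that B⁵ and A⁵ are explicit quintic forms in x, y over E(q⁵)³
(`quintic_transformation`). Replacing q by ζq with ζ⁵ = 1 only replaces y by ζy. Averaging F_n(q)
over ζ thus keeps the monomials in x⁵ and y⁵, leaving a quartic form in B(q⁵)⁵ and A(q⁵)⁵ whose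
coefficients are transformed by the given matrix (`sum_fifth_roots_quinticF`). -/

open Filter Topology

/-! ### Jacobi triple product -/

/-- The Euler product `∏ (1 - q ^ (n + 1))`. -/
noncomputable def eulerProd (q : ℂ) : ℂ := ∏' n : ℕ, (1 - q ^ (n + 1))

/-- The partial products of `eulerProd`. -/
noncomputable def eulerPartial (q : ℂ) (m : ℕ) : ℂ := ∏ k ∈ Finset.range m, (1 - q ^ (k + 1))

/-- The reciprocals of `eulerPartial`, extended by `0` to negative integers. -/
noncomputable def eulerPartialInv (q : ℂ) (m : ℤ) : ℂ :=
  if 0 ≤ m then (eulerPartial q m.toNat)⁻¹ else 0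

theorem one_sub_pow_ne_zero {q : ℂ} (hq : ‖q‖ < 1) (k : ℕ) : 1 - q ^ (k + 1) ≠ 0 := by
  intro h
  have h1 : ‖q ^ (k + 1)‖ = 1 := by rw [← sub_eq_zero.mp h]; simp
  rw [norm_pow] at h1
  exact (pow_lt_one₀ (norm_nonneg q) hq (Nat.succ_ne_zero k)).ne h1

theorem eulerPartial_ne_zero {q : ℂ} (hq : ‖q‖ < 1) (m : ℕ) : eulerPartial q m ≠ 0 :=
  Finset.prod_ne_zero_iff.mpr fun k _ => one_sub_pow_ne_zero hq k

theorem tendsto_eulerPartial {q : ℂ} (hq : ‖q‖ < 1) :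
    Tendsto (eulerPartial q) atTop (𝓝 (eulerProd q)) :=
  (ModularForm.multipliable_one_sub_pow hq).tendsto_prod_tprod_nat

theorem eulerProd_ne_zero {q : ℂ} (hq : ‖q‖ < 1) : eulerProd q ≠ 0 := by
  have := tprod_one_add_ne_zero_of_summable (f := fun n : ℕ => -q ^ (n + 1))
    (fun n => by simpa [← sub_eq_add_neg] using one_sub_pow_ne_zero hq n)
    (by
      have h := (summable_nat_add_iff 1).mpr (summable_geometric_of_lt_one (norm_nonneg q) hq)
      simpa using h)
  simpa [eulerProd, ← sub_eq_add_neg] using this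

/-- With the value 0 at negative integers this holds for every integer m (at m = 0 the factor 1 - q⁰
vanishes), so the recursion below needs no boundary cases. -/
theorem eulerPartialInv_sub_one {q : ℂ} (hq : ‖q‖ < 1) (m : ℤ) :
    eulerPartialInv q (m - 1) = (1 - q ^ m) * eulerPartialInv q m := by
  rcases lt_trichotomy m 0 with h | rfl | h
  · simp [eulerPartialInv, not_le.mpr h, show ¬ (1 : ℤ) ≤ m by omega]
  · simp [eulerPartialInv]
  · obtain ⟨k, rfl⟩ : ∃ k : ℕ, m = k + 1 := ⟨(m - 1).toNat, by omega⟩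
    have h1 := one_sub_pow_ne_zero hq k
    have h2 := eulerPartial_ne_zero hq k
    have h3 : eulerPartial q (k + 1) = eulerPartial q k * (1 - q ^ (k + 1)) :=
      Finset.prod_range_succ _ _
    have h4 : q ^ ((k : ℤ) + 1) = q ^ (k + 1) := by exact_mod_cast zpow_natCast q (k + 1)
    have h5 : ((k : ℤ) + 1).toNat = k + 1 := by omega
    simp only [eulerPartialInv, add_sub_cancel_right, Nat.cast_nonneg, if_true, Int.toNat_natCast,
      h4, h5, h3, show (0 : ℤ) ≤ k + 1 by omega]
    field_simp

theorem triangular_succ (j : ℤ) : (j + 1) * (j + 1 - 1) / 2 = j * (j - 1) / 2 + j := by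
  rw [show (j + 1) * (j + 1 - 1) = j * (j - 1) + j * 2 by ring,
    Int.add_mul_ediv_right _ _ two_ne_zero]

/-- The summand of the finite Jacobi triple product. -/
noncomputable def tripleProductTerm (p z : ℂ) (n : ℕ) (j : ℤ) : ℂ :=
  (-1) ^ j * z ^ j * p ^ (j * (j - 1) / 2) *
    (eulerPartial p (2 * n) * eulerPartialInv p (n + j) * eulerPartialInv p (n - j))

/-- This is the coefficient form of multiplication by (1 - zpⁿ)(1 - pⁿ⁺¹/z) = 1 + p²ⁿ⁺¹ - zpⁿ -
pⁿ⁺¹/z; the bracket in the summand is the Gaussian binomial of 2n over n + j. -/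
theorem tripleProductTerm_succ {p z : ℂ} (hp : ‖p‖ < 1) (hp0 : p ≠ 0) (hz : z ≠ 0) (n : ℕ)
    (j : ℤ) : tripleProductTerm p z (n + 1) j =
      (1 + p ^ (2 * n + 1)) * tripleProductTerm p z n j -
        z * p ^ n * tripleProductTerm p z n (j - 1) -
        p ^ (n + 1) / z * tripleProductTerm p z n (j + 1) := by
  have e1 := triangular_succ j
  have e2 := triangular_succ (j - 1)
  rw [sub_add_cancel] at e2
  have hpn : eulerPartial p (2 * (n + 1)) =
      eulerPartial p (2 * n) * (1 - p ^ (2 * n + 1)) * (1 - p ^ (2 * n + 2)) := by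
    rw [show 2 * (n + 1) = 2 * n + 1 + 1 by ring, eulerPartial, Finset.prod_range_succ,
      Finset.prod_range_succ]; rfl
  have g1 := eulerPartialInv_sub_one hp ((n : ℤ) + 1 + j)
  have g2 := eulerPartialInv_sub_one hp ((n : ℤ) + 1 - j)
  have g3 := eulerPartialInv_sub_one hp ((n : ℤ) + j)
  have g4 := eulerPartialInv_sub_one hp ((n : ℤ) - j)
  rw [show (n : ℤ) + 1 + j - 1 = n + j by ring] at g1
  rw [show (n : ℤ) + 1 - j - 1 = n - j by ring] at g2
  -- All reciprocals are expressed through those at n + 1 + j and n + 1 - j, which leaves an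
  -- identity of rational functions.
  rw [g1] at g3
  rw [g2] at g4
  have hu : p ^ ((n : ℤ) + 1 + j) = p ^ (n + 1) * p ^ j := by
    rw [zpow_add₀ hp0]; norm_cast
  have hv : p ^ ((n : ℤ) + 1 - j) = p ^ (n + 1) * (p ^ j)⁻¹ := by
    rw [zpow_sub₀ hp0]; norm_cast
  have hu' : p ^ ((n : ℤ) + j) = p ^ n * p ^ j := by
    rw [zpow_add₀ hp0]; norm_cast
  have hv' : p ^ ((n : ℤ) - j) = p ^ n * (p ^ j)⁻¹ := by
    rw [zpow_sub₀ hp0]; norm_cast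
  have s1 : (-1 : ℂ) ^ (j - 1) = -(-1) ^ j := by
    rw [zpow_sub₀ (by norm_num)]; simp [div_neg]
  have s2 : (-1 : ℂ) ^ (j + 1) = -(-1) ^ j := by
    rw [zpow_add₀ (by norm_num)]; simp
  have z1 : z ^ (j - 1) = z ^ j / z := by rw [zpow_sub_one₀ hz]; rfl
  have z2 : z ^ (j + 1) = z ^ j * z := zpow_add_one₀ hz j
  have p1 : p ^ ((j - 1) * (j - 1 - 1) / 2) = p ^ (j * (j - 1) / 2) * p / p ^ j := by
    rw [show (j - 1) * (j - 1 - 1) / 2 = j * (j - 1) / 2 + 1 - j by rw [e2]; ring,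
      zpow_sub₀ hp0, zpow_add₀ hp0]; simp
  have p2 : p ^ ((j + 1) * (j + 1 - 1) / 2) = p ^ (j * (j - 1) / 2) * p ^ j := by
    rw [e1, zpow_add₀ hp0]
  have c1 : ((n : ℤ) + (j - 1)) = n + j - 1 := by ring
  have c2 : ((n : ℤ) - (j - 1)) = n + 1 - j := by ring
  have c3 : ((n : ℤ) + (j + 1)) = n + 1 + j := by ring
  have c4 : ((n : ℤ) - (j + 1)) = n - j - 1 := by ring
  push_cast [tripleProductTerm]
  simp only [hpn, c1, c2, c3, c4, g3, g4, g1, g2, s1, s2, z1, z2, p1, p2, hu, hv, hu', hv']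
  have hj : p ^ j ≠ 0 := zpow_ne_zero _ hp0
  generalize p ^ j = P at *
  generalize p ^ (j * (j - 1) / 2) = Q at *
  generalize z ^ j = Z at *
  generalize (-1 : ℂ) ^ j = s at *
  generalize eulerPartialInv p (n + 1 + j) = G at *
  generalize eulerPartialInv p (n + 1 - j) = H at *
  generalize eulerPartial p (2 * n) = R at *
  field_simp
  ring

/-- The finite form of the Jacobi triple product. -/
theorem hasSum_finite_triple_product {p z : ℂ} (hp : ‖p‖ < 1) (hp0 : p ≠ 0) (hz : z ≠ 0) (n : ℕ) :
    HasSum (tripleProductTerm p z n)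
      (∏ k ∈ Finset.range n, ((1 - z * p ^ k) * (1 - p ^ (k + 1) / z))) := by
  induction n with
  | zero =>
    have h := hasSum_single (f := tripleProductTerm p z 0) 0 fun j hj => by
      rcases lt_or_gt_of_ne hj with h | h
      · simp [tripleProductTerm, eulerPartialInv, not_le.mpr h]
      · simp [tripleProductTerm, eulerPartialInv, not_le.mpr h]
    simpa [tripleProductTerm, eulerPartial, eulerPartialInv] using h
  | succ n ih =>
    have h1 := (Equiv.subRight (1 : ℤ)).hasSum_iff.mpr ih
    have h2 := (Equiv.addRight (1 : ℤ)).hasSum_iff.mpr ih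
    have h3 := ((ih.mul_left (1 + p ^ (2 * n + 1))).sub (h1.mul_left (z * p ^ n))).sub
      (h2.mul_left (p ^ (n + 1) / z))
    rw [Finset.prod_range_succ]
    convert! h3 using 1
    · exact funext fun j => tripleProductTerm_succ hp hp0 hz n j
    · field_simp
      ring

/-- The Jacobi triple product, as a limit of partial products. -/
theorem tendsto_triple_product {p z : ℂ} (hp : ‖p‖ < 1) (hp0 : p ≠ 0) (hz : z ≠ 0)
    (hs : Summable fun j : ℤ => ‖(-1) ^ j * z ^ j * p ^ (j * (j - 1) / 2)‖) :
    Tendsto (fun n => eulerPartial p n *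
        ∏ k ∈ Finset.range n, ((1 - z * p ^ k) * (1 - p ^ (k + 1) / z))) atTop
      (𝓝 (∑' j : ℤ, (-1) ^ j * z ^ j * p ^ (j * (j - 1) / 2))) := by
  have hE := eulerProd_ne_zero hp
  have h1 := tendsto_eulerPartial hp
  have h2 : Tendsto (fun n => (eulerPartial p n)⁻¹) atTop (𝓝 (eulerProd p)⁻¹) := h1.inv₀ hE
  obtain ⟨C, hC⟩ := h1.norm.bddAbove_range
  obtain ⟨D, hD⟩ := h2.norm.bddAbove_range
  have hC' : ∀ n, ‖eulerPartial p n‖ ≤ C := fun n => hC ⟨n, rfl⟩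
  have hD' : ∀ n : ℕ, ‖(eulerPartial p n)⁻¹‖ ≤ D := fun n => hD ⟨n, rfl⟩
  have hD0 : 0 ≤ D := (norm_nonneg _).trans (hD' 0)
  have hC0 : 0 ≤ C := (norm_nonneg _).trans (hC' 0)
  have hG : ∀ m, ‖eulerPartialInv p m‖ ≤ D := by
    intro m
    unfold eulerPartialInv
    split_ifs
    · exact hD' _
    · simpa using hD0
  have ht : ∀ j : ℤ, Tendsto (fun n : ℕ => eulerPartialInv p (n + j)) atTop
      (𝓝 (eulerProd p)⁻¹) := by
    intro j
    have h3 : Tendsto (fun n : ℕ => ((n : ℤ) + j).toNat) atTop atTop :=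
      tendsto_atTop.mpr fun b => by
        filter_upwards [eventually_ge_atTop (b + j.natAbs)] with n hn
        omega
    refine (h2.comp h3).congr' ?_
    filter_upwards [eventually_ge_atTop j.natAbs] with n hn
    rw [eulerPartialInv, if_pos (by omega)]
    rfl
  -- Dominated convergence: the Gaussian binomials are bounded uniformly by C·D·D and tend to
  -- 1/E(p).
  have key : Tendsto (fun n : ℕ => ∑' j : ℤ, tripleProductTerm p z n j) atTop
      (𝓝 (∑' j : ℤ, (-1) ^ j * z ^ j * p ^ (j * (j - 1) / 2) *
        (eulerProd p * (eulerProd p)⁻¹ * (eulerProd p)⁻¹))) := by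
    refine tendsto_tsum_of_dominated_convergence
      (bound := fun j : ℤ => ‖(-1) ^ j * z ^ j * p ^ (j * (j - 1) / 2)‖ * (C * D * D))
      (hs.mul_right _) (fun j => ?_) (Eventually.of_forall fun n j => ?_)
    · refine Tendsto.const_mul _ (Tendsto.mul (Tendsto.mul ?_ (ht j)) ?_)
      · exact h1.comp (tendsto_id.const_mul_atTop' two_pos)
      · simpa [sub_eq_add_neg] using ht (-j)
    · rw [tripleProductTerm, norm_mul, norm_mul (eulerPartial p (2 * n) * _), norm_mul (eulerPartial p (2 * n))]
      gcongr
      · exact hC' _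
      · exact hG _
      · exact hG _
  simp_rw [(hasSum_finite_triple_product hp hp0 hz _).tsum_eq] at key
  have := h1.mul key
  rw [tsum_mul_right] at this
  convert! this using 2
  field_simp

/-! ### Quintic theta series and their product -/

/-- The theta series `∑ (-1) ^ n q ^ ((5 n ^ 2 - c n) / 2)`. -/
noncomputable def quinticTheta (c : ℤ) (q : ℂ) : ℂ :=
  ∑' n : ℤ, (-1 : ℂ) ^ n * q ^ ((5 * n ^ 2 - c * n) / 2)

/-- The exponent is nonnegative, zero only at n = 0, and large enough for comparison with a
geometric series. -/
theorem abs_le_quintic_exponent {c : ℤ} (hc : |c| ≤ 3) (n : ℤ) :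
    |n| ≤ (5 * n ^ 2 - c * n) / 2 := by
  have h1 : c * n ≤ 3 * |n| := (le_abs_self _).trans (by rw [abs_mul]; gcongr)
  have h3 := le_abs_self n
  have h4 := neg_abs_le n
  have h5 := abs_nonneg n
  have h2 : |n| ≤ n ^ 2 := by
    rw [← sq_abs]
    rcases (abs_nonneg n).eq_or_lt with h | h
    · rw [← h]; norm_num
    · nlinarith
  omega

theorem summable_pow_natAbs {r : ℝ} (h0 : 0 ≤ r) (h1 : r < 1) :
    Summable fun n : ℤ => r ^ n.natAbs := by
  refine Summable.of_nat_of_neg ?_ ?_ <;> simpa using summable_geometric_of_lt_one h0 h1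

theorem norm_quinticTheta_term_le {c : ℤ} (hc : |c| ≤ 3) {q : ℂ} {r : ℝ} (hq : ‖q‖ ≤ r)
    (hr : r ≤ 1) (n : ℤ) :
    ‖(-1 : ℂ) ^ n * q ^ ((5 * n ^ 2 - c * n) / 2)‖ ≤ r ^ n.natAbs := by
  obtain ⟨k, hk⟩ := Int.eq_ofNat_of_zero_le ((abs_nonneg n).trans (abs_le_quintic_exponent hc n))
  have h1 := abs_le_quintic_exponent hc n
  rw [hk, Int.abs_eq_natAbs] at h1
  rw [hk]
  have h2 : n.natAbs ≤ k := by omega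
  simp only [norm_mul, norm_zpow, norm_neg, norm_one, one_zpow, one_mul, zpow_natCast, norm_pow]
  exact (pow_le_pow_left₀ (norm_nonneg _) hq k).trans
    (pow_le_pow_of_le_one ((norm_nonneg _).trans hq) hr h2)

theorem summable_norm_quinticTheta_term {c : ℤ} (hc : |c| ≤ 3) {q : ℂ} (hq : ‖q‖ < 1) :
    Summable fun n : ℤ => ‖(-1 : ℂ) ^ n * q ^ ((5 * n ^ 2 - c * n) / 2)‖ :=
  Summable.of_nonneg_of_le (fun _ => norm_nonneg _)
    (norm_quinticTheta_term_le hc le_rfl hq.le) (summable_pow_natAbs (norm_nonneg q) hq)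

/-- Triple product with p = q⁵ and z = qᵐ; m = 1 gives c = 3 and m = 2 gives c = 1. -/
theorem quinticTheta_term_eq {q : ℂ} (hq0 : q ≠ 0) (m : ℕ) (j : ℤ) :
    (-1 : ℂ) ^ j * (q ^ m) ^ j * (q ^ 5) ^ (j * (j - 1) / 2) =
      (-1) ^ j * q ^ ((5 * j ^ 2 - (5 - 2 * m) * j) / 2) := by
  rw [mul_assoc]
  congr 1
  rw [← zpow_natCast, ← zpow_natCast, ← zpow_mul, ← zpow_mul, ← zpow_add₀ hq0]
  congr 1
  obtain ⟨t, ht⟩ : Even (j * (j - 1)) := Int.even_mul_pred_self j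
  have : 5 * j ^ 2 - (5 - 2 * (m : ℤ)) * j = 2 * (m * j + 5 * t) := by
    linear_combination 5 * ht
  rw [this, ht, ← two_mul]
  simp

theorem tendsto_quinticTheta {q : ℂ} (hq : ‖q‖ < 1) (hq0 : q ≠ 0) {m : ℕ} (h1 : 1 ≤ m)
    (h4 : m ≤ 4) :
    Tendsto (fun n => eulerPartial (q ^ 5) n *
        ∏ k ∈ Finset.range n, ((1 - q ^ (5 * k + m)) * (1 - q ^ (5 * k + 5 - m)))) atTop
      (𝓝 (quinticTheta (5 - 2 * m) q)) := by
  have hc : |(5 - 2 * m : ℤ)| ≤ 3 := by rw [abs_le]; omega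
  have hs := summable_norm_quinticTheta_term hc hq
  simp_rw [quinticTheta, ← quinticTheta_term_eq hq0] at hs ⊢
  have hq5 : ‖q ^ 5‖ < 1 := by rw [norm_pow]; exact pow_lt_one₀ (norm_nonneg q) hq (by norm_num)
  refine (tendsto_triple_product hq5 (pow_ne_zero 5 hq0) (pow_ne_zero m hq0) hs).congr fun n => ?_
  congr 1
  refine Finset.prod_congr rfl fun k _ => ?_
  congr 2
  · ring
  · rw [div_eq_iff (pow_ne_zero m hq0), ← pow_add, ← pow_mul]
    congr 1
    omega

theorem quinticTheta_zero {c : ℤ} (hc : |c| ≤ 3) : quinticTheta c 0 = 1 := by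
  rw [quinticTheta, tsum_eq_single 0]
  · simp
  · intro n hn
    have := abs_le_quintic_exponent hc n
    have h2 : (5 * n ^ 2 - c * n) / 2 ≠ 0 := by
      have := abs_pos.mpr hn
      omega
    rw [zero_zpow _ h2, mul_zero]

theorem eulerProd_zero : eulerProd 0 = 1 := by simp [eulerProd]

theorem eulerPartial_five_mul (q : ℂ) (n : ℕ) : eulerPartial q (5 * n) =
    (∏ k ∈ Finset.range n, ((1 - q ^ (5 * k + 1)) * (1 - q ^ (5 * k + 4)))) *
    (∏ k ∈ Finset.range n, ((1 - q ^ (5 * k + 2)) * (1 - q ^ (5 * k + 3)))) *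
    eulerPartial (q ^ 5) n := by
  induction n with
  | zero => simp [eulerPartial]
  | succ n ih =>
    have h : eulerPartial q (5 * (n + 1)) = eulerPartial q (5 * n) * (1 - q ^ (5 * n + 1)) *
        (1 - q ^ (5 * n + 2)) * (1 - q ^ (5 * n + 3)) * (1 - q ^ (5 * n + 4)) *
        (1 - q ^ (5 * n + 5)) := by
      simp only [eulerPartial, show 5 * (n + 1) = 5 * n + 1 + 1 + 1 + 1 + 1 by ring,
        Finset.prod_range_succ]
    rw [h, ih, Finset.prod_range_succ, Finset.prod_range_succ]
    simp only [eulerPartial, Finset.prod_range_succ]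
    ring

/-- The two quintic theta series multiply to `(q; q)_∞ (q⁵; q⁵)_∞`. -/
theorem quinticTheta_mul {q : ℂ} (hq : ‖q‖ < 1) :
    quinticTheta 3 q * quinticTheta 1 q = eulerProd q * eulerProd (q ^ 5) := by
  rcases eq_or_ne q 0 with rfl | hq0
  · simp [quinticTheta_zero, eulerProd_zero]
  have hq5 : ‖q ^ 5‖ < 1 := by rw [norm_pow]; exact pow_lt_one₀ (norm_nonneg q) hq (by norm_num)
  have h1 := (tendsto_quinticTheta hq hq0 (m := 1) (by norm_num) (by norm_num)).mul
    (tendsto_quinticTheta hq hq0 (m := 2) (by norm_num) (by norm_num))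
  -- The residue classes 1, 4, 2, 3 and one factor (q⁵; q⁵) fill up (q; q), so partial products are
  -- compared along multiples of 5.
  have h2 := ((tendsto_eulerPartial hq).comp (tendsto_id.const_mul_atTop' (r := 5) (by norm_num))).mul
    (tendsto_eulerPartial hq5)
  norm_num at h1
  refine tendsto_nhds_unique h1 (h2.congr fun n => ?_)
  simp only [Function.comp, id, eulerPartial_five_mul]
  simp only [show ∀ k, 5 * k + 5 - 2 = 5 * k + 3 by omega, Finset.prod_mul_distrib]
  ring

/-! ### Quintic dissection -/

/-- The summand `(-1) ^ n q ^ (n (n - 1) / 2)`. -/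
noncomputable def triangularTerm (q : ℂ) (n : ℤ) : ℂ := (-1) ^ n * q ^ (n * (n - 1) / 2)

/-- The part of `∑ (-1) ^ n q ^ (n (n - 1) / 2)` over the residue class of `c` modulo `5`. -/
noncomputable def triangularSection (q : ℂ) (c : ℤ) : ℂ := ∑' m : ℤ, triangularTerm q (5 * m + c)

theorem two_mul_triangular (n : ℤ) : 2 * (n * (n - 1) / 2) = n * (n - 1) :=
  Int.mul_ediv_cancel' (Int.even_mul_pred_self n).two_dvd

theorem neg_one_zpow_congr {m n : ℤ} (h : Even (m - n)) : (-1 : ℂ) ^ m = (-1) ^ n := by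
  have h1 : m = n + (m - n) := by ring
  rw [h1, zpow_add₀ (by norm_num), h.neg_one_zpow, mul_one]

theorem summable_norm_triangularTerm {q : ℂ} (hq : ‖q‖ < 1) (c : ℤ) :
    Summable fun m : ℤ => ‖triangularTerm q (5 * m + c)‖ := by
  suffices h : Summable fun n : ℤ => ‖triangularTerm q n‖ from
    h.comp_injective (i := fun m : ℤ => 5 * m + c) fun x y hxy => by simp at hxy; omega
  -- The exponent n(n - 1)/2 vanishes at n = 1 too, hence |n| - 1; truncated subtraction gives 0 at
  -- n = 0.
  have hb : Summable fun n : ℤ => ‖q‖ ^ (n.natAbs - 1) := by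
    refine Summable.of_nat_of_neg ?_ ?_ <;>
    · rw [← summable_nat_add_iff 1]
      refine (summable_geometric_of_lt_one (norm_nonneg q) hq).congr fun n => ?_
      congr 1
  refine Summable.of_nonneg_of_le (fun _ => norm_nonneg _) (fun n => ?_) hb
  have h1 := two_mul_triangular n
  have h2 : (n.natAbs : ℤ) - 1 ≤ n * (n - 1) / 2 := by
    rcases le_total 0 n with h | h
    · have : (n.natAbs : ℤ) = n := by omega
      have : n = 0 ∨ n = 1 ∨ 2 ≤ n := by omega
      rcases this with h | h | h
      · simp [h]
      · simp [h]
      · nlinarith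
    · have : (n.natAbs : ℤ) = -n := by omega
      nlinarith [sq_nonneg (2 * n + 1)]
  have h3 : 0 ≤ n * (n - 1) / 2 := by
    rcases le_or_gt n 0 with h | h <;> nlinarith
  obtain ⟨k, hk⟩ := Int.eq_ofNat_of_zero_le h3
  rw [hk] at h2
  simp only [triangularTerm, hk, norm_mul, norm_zpow, norm_neg, norm_one, one_zpow, one_mul,
    zpow_natCast, norm_pow]
  exact pow_le_pow_of_le_one (norm_nonneg q) hq.le (by omega)

/-- Multiplication by 2 + i: (2m - n)² + (m + 2n)² = 5(m² + n²), while the linear parts add up to 3m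
+ n. -/
theorem quinticTheta_term_mul {q : ℂ} (hq0 : q ≠ 0) (m n : ℤ) :
    ((-1 : ℂ) ^ m * q ^ ((5 * m ^ 2 - 3 * m) / 2)) * ((-1) ^ n * q ^ ((5 * n ^ 2 - 1 * n) / 2)) =
      triangularTerm q (2 * m - n) * triangularTerm q (m + 2 * n) := by
  rw [triangularTerm, triangularTerm, mul_mul_mul_comm, mul_mul_mul_comm ((-1 : ℂ) ^ (2 * m - n)),
    ← zpow_add₀ hq0, ← zpow_add₀ hq0, ← zpow_add₀ (by norm_num), ← zpow_add₀ (by norm_num)]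
  congr 1
  · exact neg_one_zpow_congr ⟨-m, by ring⟩
  · congr 1
    have h1 := two_mul_triangular (2 * m - n)
    have h2 := two_mul_triangular (m + 2 * n)
    have h3 := two_mul_triangular m
    have h4 := two_mul_triangular n
    have h5 : 5 * m ^ 2 - 3 * m = 2 * (5 * (m * (m - 1) / 2) + m) := by linear_combination -5 * h3
    have h6 : 5 * n ^ 2 - 1 * n = 2 * (5 * (n * (n - 1) / 2) + 2 * n) := by
      linear_combination -5 * h4
    rw [h5, h6, Int.mul_ediv_cancel_left _ two_ne_zero, Int.mul_ediv_cancel_left _ two_ne_zero]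
    apply mul_left_cancel₀ (two_ne_zero (α := ℤ))
    linear_combination 5 * h3 + 5 * h4 - h1 - h2

theorem triangularTerm_one_sub (q : ℂ) (n : ℤ) :
    triangularTerm q (1 - n) = -triangularTerm q n := by
  have h : (-1 : ℂ) ^ (1 - n) = -(-1) ^ n := by
    rw [zpow_sub₀ (by norm_num)]
    rcases Int.even_or_odd n with h | h <;> simp [h.neg_one_zpow]
  rw [triangularTerm, triangularTerm, h, show (1 - n) * (1 - n - 1) = n * (n - 1) by ring, neg_mul]

theorem triangularSection_add_five (q : ℂ) (c : ℤ) :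
    triangularSection q (c + 5) = triangularSection q c := by
  rw [triangularSection, triangularSection, ← (Equiv.addRight (-1 : ℤ)).tsum_eq]
  refine tsum_congr fun m => ?_
  rw [Equiv.coe_addRight]
  congr 1
  ring

/-- The reflection n ↦ 1 - n fixes n(n - 1)/2 and flips the sign; it pairs class 0 with 1 and 2 with
4, and kills the self-paired class 3. -/
theorem triangularSection_one_sub (q : ℂ) (c : ℤ) :
    triangularSection q (1 - c) = -triangularSection q c := by
  rw [triangularSection, triangularSection, ← (Equiv.neg ℤ).tsum_eq, ← tsum_neg]
  refine tsum_congr fun m => ?_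
  rw [← triangularTerm_one_sub, Equiv.neg_apply]
  congr 1
  ring

theorem triangularSection_zero (q : ℂ) :
    triangularSection q 0 = quinticTheta 1 (q ^ 5) := by
  refine tsum_congr fun m => ?_
  rw [triangularTerm, ← zpow_natCast, ← zpow_mul]
  congr 1
  · exact neg_one_zpow_congr ⟨2 * m, by ring⟩
  · congr 1
    have h1 := two_mul_triangular (5 * m + 0)
    have h2 : 2 * ((5 * m ^ 2 - 1 * m) / 2) = 5 * m ^ 2 - 1 * m := by
      have h4 := two_mul_triangular m
      have h6 : 5 * m ^ 2 - 1 * m = 2 * (5 * (m * (m - 1) / 2) + 2 * m) := by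
        linear_combination -5 * h4
      rw [h6, Int.mul_ediv_cancel_left _ two_ne_zero]
    apply mul_left_cancel₀ (two_ne_zero (α := ℤ))
    push_cast
    linear_combination h1 - 5 * h2

theorem triangularSection_two {q : ℂ} (hq0 : q ≠ 0) :
    triangularSection q 2 = q * quinticTheta 3 (q ^ 5) := by
  rw [triangularSection, quinticTheta, ← (Equiv.neg ℤ).tsum_eq, ← tsum_mul_left]
  refine tsum_congr fun m => ?_
  rw [triangularTerm, ← zpow_natCast, ← zpow_mul, mul_left_comm, ← zpow_one_add₀ hq0,
    Equiv.neg_apply]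
  congr 1
  · exact neg_one_zpow_congr ⟨1 - 3 * m, by ring⟩
  · congr 1
    have h1 := two_mul_triangular (5 * -m + 2)
    have h2 : 2 * ((5 * m ^ 2 - 3 * m) / 2) = 5 * m ^ 2 - 3 * m := by
      have h4 := two_mul_triangular m
      have h6 : 5 * m ^ 2 - 3 * m = 2 * (5 * (m * (m - 1) / 2) + m) := by
        linear_combination -5 * h4
      rw [h6, Int.mul_ediv_cancel_left _ two_ne_zero]
    apply mul_left_cancel₀ (two_ne_zero (α := ℤ))
    push_cast
    linear_combination h1 - 5 * h2

/-- The index `2 m - n` is written as `5 k + r`; then `m + 2 n = 5 l - 2 r`. -/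
noncomputable def quinticIndexEquiv : Fin 5 × (ℤ × ℤ) ≃ ℤ × ℤ :=
  Equiv.ofBijective (fun x => (x.2.2 + 2 * x.2.1, 2 * x.2.2 - x.2.1 - x.1.val)) <| by
    constructor
    · rintro ⟨r, k, l⟩ ⟨r', k', l'⟩ h
      simp only [Prod.mk.injEq] at h
      have h1 : r = r' := Fin.ext (by omega)
      subst h1
      simp only [Prod.mk.injEq, true_and]
      omega
    · rintro ⟨m, n⟩
      refine ⟨(⟨((2 * m - n) % 5).toNat, by omega⟩, (2 * m - n) / 5, m - 2 * ((2 * m - n) / 5)), ?_⟩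
      simp only [Prod.mk.injEq]
      omega

theorem quinticIndexEquiv_apply (x : Fin 5 × (ℤ × ℤ)) :
    quinticIndexEquiv x = (x.2.2 + 2 * x.2.1, 2 * x.2.2 - x.2.1 - x.1.val) := rfl

/-- The quintic dissection of `(q; q)_∞ (q⁵; q⁵)_∞`, in terms of theta series. -/
theorem quinticTheta_mul_dissection {q : ℂ} (hq : ‖q‖ < 1) :
    quinticTheta 3 q * quinticTheta 1 q = quinticTheta 1 (q ^ 5) ^ 2 -
      q * quinticTheta 3 (q ^ 5) * quinticTheta 1 (q ^ 5) - (q * quinticTheta 3 (q ^ 5)) ^ 2 := by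
  rcases eq_or_ne q 0 with rfl | hq0
  · simp [quinticTheta_zero]
  have hs3 := summable_norm_quinticTheta_term (c := 3) (by norm_num) hq
  have hs1 := summable_norm_quinticTheta_term (c := 1) (by norm_num) hq
  have hS := summable_mul_of_summable_norm hs3 hs1
  rw [quinticTheta, quinticTheta, tsum_mul_tsum_of_summable_norm hs3 hs1,
    ← quinticIndexEquiv.tsum_eq]
  rw [← quinticIndexEquiv.summable_iff] at hS
  have hT : ∀ x : Fin 5 × (ℤ × ℤ),
      (-1 : ℂ) ^ (quinticIndexEquiv x).1 *
        q ^ ((5 * (quinticIndexEquiv x).1 ^ 2 - 3 * (quinticIndexEquiv x).1) / 2) *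
      ((-1) ^ (quinticIndexEquiv x).2 *
        q ^ ((5 * (quinticIndexEquiv x).2 ^ 2 - 1 * (quinticIndexEquiv x).2) / 2)) =
      triangularTerm q (5 * x.2.1 + x.1.val) * triangularTerm q (5 * x.2.2 + -2 * x.1.val) := by
    intro x
    rw [quinticTheta_term_mul hq0]
    simp only [quinticIndexEquiv_apply]
    congr 2 <;> ring
  simp only [Function.comp_def, hT] at hS ⊢
  rw [hS.tsum_prod, tsum_fintype]
  have hW : ∀ r : Fin 5, ∑' x : ℤ × ℤ, triangularTerm q (5 * x.1 + r.val) *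
      triangularTerm q (5 * x.2 + -2 * r.val) =
      triangularSection q r.val * triangularSection q (-2 * r.val) := fun r =>
    (tsum_mul_tsum_of_summable_norm (summable_norm_triangularTerm hq _)
      (summable_norm_triangularTerm hq _)).symm
  simp only [hW, Fin.sum_univ_five]
  -- With W_c the section of class c, the sum is ∑ W_r W_{-2r}. Here W₃ = 0, W₁ = -W₀ and W₄ = -W₂,
  -- leaving W₀² - W₀W₂ - W₂².
  have p1 := triangularSection_add_five q (-2)
  have p2 := triangularSection_add_five q (-4)
  have p3 := triangularSection_add_five q (-1)
  have p4 := triangularSection_add_five q (-8)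
  have p5 := triangularSection_add_five q (-3)
  have n1 := triangularSection_one_sub q 0
  have n2 := triangularSection_one_sub q 3
  have n3 := triangularSection_one_sub q 2
  norm_num at p1 p2 p3 p4 p5 n1 n2 n3
  have w3 : triangularSection q 3 = 0 := by
    have : triangularSection q 3 = -triangularSection q 3 := p1.trans n2
    linear_combination this / 2
  have w2 : triangularSection q (-2) = 0 := by rw [← p1, w3]
  norm_num [w3, w2, ← p2, n1, p3, n3, ← p4, ← p5, triangularSection_zero q,
    triangularSection_two hq0]
  ring

/-! ### Analyticity on the disc -/

theorem differentiableOn_quinticTheta {c : ℤ} (hc : |c| ≤ 3) :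
    DifferentiableOn ℂ (quinticTheta c) (Metric.ball 0 1) := by
  intro q hq
  obtain ⟨r, hqr, hr⟩ := exists_between (mem_ball_zero_iff.mp hq)
  have h : DifferentiableOn ℂ (quinticTheta c) (Metric.ball 0 r) := by
    refine Complex.differentiableOn_tsum_of_summable_norm
      (summable_pow_natAbs ((norm_nonneg q).trans hqr.le) hr) (fun n => ?_) Metric.isOpen_ball
      fun n w hw => norm_quinticTheta_term_le hc (mem_ball_zero_iff.mp hw).le hr.le n
    obtain ⟨k, hk⟩ := Int.eq_ofNat_of_zero_le ((abs_nonneg n).trans (abs_le_quintic_exponent hc n))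
    simp only [hk, zpow_natCast]
    fun_prop
  exact (h.differentiableAt (Metric.isOpen_ball.mem_nhds (by simpa using hqr))).differentiableWithinAt

theorem differentiableOn_eulerProd : DifferentiableOn ℂ eulerProd (Metric.ball 0 1) :=
  ModularForm.differentiableOn_tprod_one_sub_pow

/-- Analytic functions on the unit disc with `f² = g²` and the same nonzero value at `0` agree. -/
theorem eqOn_of_sq_eq_sq {f g : ℂ → ℂ} (hf : DifferentiableOn ℂ f (Metric.ball 0 1))
    (hg : DifferentiableOn ℂ g (Metric.ball 0 1))
    (h : ∀ q : ℂ, ‖q‖ < 1 → f q ^ 2 = g q ^ 2) (h0 : f 0 = g 0) (hg0 : g 0 ≠ 0) {q : ℂ}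
    (hq : ‖q‖ < 1) : f q = g q := by
  have hmem : (0 : ℂ) ∈ Metric.ball (0 : ℂ) 1 := Metric.mem_ball_self one_pos
  have hball := Metric.isOpen_ball.mem_nhds hmem
  have hc : ContinuousAt (fun q => f q + g q) 0 :=
    ((hf.differentiableAt hball).add (hg.differentiableAt hball)).continuousAt
  have hne : f 0 + g 0 ≠ 0 := by
    rw [h0, ← two_mul]
    exact mul_ne_zero two_ne_zero hg0
  have hev : f =ᶠ[𝓝 0] g := by
    filter_upwards [hc.eventually_ne hne, hball] with x hx hx1
    have h2 := h x (by simpa using hx1)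
    have h3 : (f x - g x) * (f x + g x) = 0 := by linear_combination h2
    exact sub_eq_zero.mp ((mul_eq_zero.mp h3).resolve_right hx)
  exact (hf.analyticOnNhd Metric.isOpen_ball).eqOn_of_preconnected_of_eventuallyEq
    (hg.analyticOnNhd Metric.isOpen_ball) (convex_ball (0 : ℂ) 1).isPreconnected hmem hev
    (by simpa using hq)

/-! ### Theta constants under inversion -/

open Complex in
/-- The theta constant `∑ (-1) ^ n e ^ (2 π i τ (10 n - c) ^ 2 / 40)`. -/
noncomputable def thetaConst (c : ℤ) (τ : ℂ) : ℂ :=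
  ∑' n : ℤ, (-1 : ℂ) ^ n * cexp (2 * Real.pi * I * τ * ((10 * n - c) ^ 2 / 40))

section

open Complex

theorem thetaConst_neg (c : ℤ) (τ : ℂ) : thetaConst (-c) τ = thetaConst c τ := by
  rw [thetaConst, thetaConst, ← (Equiv.neg ℤ).tsum_eq]
  refine tsum_congr fun n => ?_
  simp only [Equiv.neg_apply, zpow_neg, ← inv_zpow, inv_neg, inv_one]
  push_cast
  congr 2
  ring

theorem thetaConst_add_ten (c : ℤ) (τ : ℂ) : thetaConst (c + 10) τ = -thetaConst c τ := by
  rw [thetaConst, thetaConst, ← (Equiv.addRight (1 : ℤ)).tsum_eq, ← tsum_neg]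
  refine tsum_congr fun n => ?_
  rw [Equiv.coe_addRight, zpow_add_one₀ (by norm_num), mul_neg_one, neg_mul]
  push_cast
  congr 3
  ring

theorem qParam_one_eq (τ : ℂ) : Function.Periodic.qParam 1 τ = cexp (2 * Real.pi * I * τ) := by
  simp [Function.Periodic.qParam]

theorem thetaConst_eq_quinticTheta {c : ℤ} (hc : Odd c) (τ : ℂ) :
    thetaConst c τ = cexp (2 * Real.pi * I * τ * (c ^ 2 / 40)) *
      quinticTheta c (Function.Periodic.qParam 1 τ) := by
  rw [thetaConst, quinticTheta, ← tsum_mul_left]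
  refine tsum_congr fun n => ?_
  have h2 : ((2 * ((5 * n ^ 2 - c * n) / 2) : ℤ) : ℂ) = 5 * n ^ 2 - c * n := by
    rw [Int.mul_ediv_cancel']
    · push_cast; ring
    · rw [← even_iff_two_dvd, show 5 * n ^ 2 - c * n = n * (5 * n - c) by ring]
      rcases Int.even_or_odd n with h | h
      · exact h.mul_right _
      · exact (((by decide : Odd (5 : ℤ)).mul h).sub_odd hc).mul_left _
  rw [qParam_one_eq, ← Complex.exp_int_mul, mul_left_comm, ← Complex.exp_add]
  congr 2
  push_cast at h2
  linear_combination (-Real.pi * I * τ) * h2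

theorem thetaConst_eq_jacobiTheta₂ (c : ℤ) (τ : ℂ) :
    thetaConst c τ = cexp (2 * Real.pi * I * τ * (c ^ 2 / 40)) *
      jacobiTheta₂ (1 / 2 - c * τ / 2) (5 * τ) := by
  rw [thetaConst, jacobiTheta₂, ← tsum_mul_left]
  refine tsum_congr fun n => ?_
  rw [jacobiTheta₂_term, ← Complex.exp_pi_mul_I, ← Complex.exp_int_mul, ← Complex.exp_add,
    ← Complex.exp_add]
  congr 1
  ring

theorem summable_jacobiTheta₂_term_shift {τ : ℂ} (hτ : 0 < τ.im) (c : ℂ) :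
    Summable fun n : ℤ => cexp (2 * Real.pi * I * τ * ((2 * n - 1) ^ 2 / 40)) *
      cexp (-Real.pi * I * c * (2 * n - 1) / 10) := by
  have h : 0 < (τ / 5).im := by
    rw [show τ / 5 = τ / ((5 : ℝ) : ℂ) by norm_num, Complex.div_ofReal_im]
    positivity
  have := ((summable_jacobiTheta₂_term_iff (-(τ + c) / 10) (τ / 5)).mpr h).mul_left
    (cexp (Real.pi * I * (τ + 2 * c) / 20))
  refine this.congr fun n => ?_
  rw [jacobiTheta₂_term, ← Complex.exp_add, ← Complex.exp_add]
  congr 1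
  ring

/-- The shifted theta series splits according to the residue of the summation index mod `5`. -/
theorem tsum_shift_eq_thetaConst {τ : ℂ} (hτ : 0 < τ.im) {c : ℤ} (hc : Odd c) :
    ∑' n : ℤ, cexp (2 * Real.pi * I * τ * ((2 * n - 1) ^ 2 / 40)) *
      cexp (-Real.pi * I * c * (2 * n - 1) / 10) =
      2 * Complex.cos (Real.pi * c / 10) * thetaConst 1 τ +
        2 * Complex.cos (3 * Real.pi * c / 10) * thetaConst 3 τ := by
  have hs := summable_jacobiTheta₂_term_shift hτ c
  rw [← ((Equiv.prodComm (Fin 5) ℤ).trans (Int.divModEquiv 5).symm).tsum_eq]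
  rw [← ((Equiv.prodComm (Fin 5) ℤ).trans (Int.divModEquiv 5).symm).summable_iff] at hs
  simp only [Function.comp_def] at hs
  rw [hs.tsum_prod, tsum_fintype]
  have hr : ∀ r : Fin 5, ∑' k : ℤ, (cexp (2 * Real.pi * I * τ *
      ((2 * (((Equiv.prodComm (Fin 5) ℤ).trans (Int.divModEquiv 5).symm) (r, k) : ℤ) - 1) ^ 2 / 40))
        * cexp (-Real.pi * I * c *
      (2 * (((Equiv.prodComm (Fin 5) ℤ).trans (Int.divModEquiv 5).symm) (r, k) : ℤ) - 1) / 10)) =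
      cexp (-Real.pi * I * c * (2 * (r.val : ℤ) - 1) / 10) *
        thetaConst (1 - 2 * (r.val : ℤ)) τ := by
    intro r
    rw [thetaConst, ← tsum_mul_left]
    refine tsum_congr fun k => ?_
    -- Since c is odd, the sign (-1)ᵏ can be absorbed into the exponential.
    have h1 : (-1 : ℂ) ^ k = cexp (-(c * k * (Real.pi * I))) := by
      have : (-1 : ℂ) ^ k = (-1) ^ (-(c * k)) := by
        refine neg_one_zpow_congr ?_
        obtain ⟨d, rfl⟩ := hc
        exact ⟨k * (d + 1), by ring⟩
      rw [this, ← Complex.exp_pi_mul_I, ← Complex.exp_int_mul]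
      push_cast
      congr 1
      ring
    rw [h1, mul_left_comm, mul_comm, ← Complex.exp_add, ← Complex.exp_add, ← Complex.exp_add]
    simp only [Equiv.trans_apply, Equiv.prodComm_apply, Prod.swap_prod_mk, Int.divModEquiv_symm_apply]
    congr 1
    push_cast
    ring
  rw [Finset.sum_congr rfl fun r _ => hr r]
  have p1 := thetaConst_neg 1 τ
  have p3 := thetaConst_neg 3 τ
  have p5 := thetaConst_neg 5 τ
  have p7 := thetaConst_add_ten (-5) τ
  have p8 := thetaConst_add_ten (-7) τ
  norm_num at p7 p8
  -- The residues r = 0, …, 4 give the indices 1, -1, -3, -5, -7. Index -5 is equivalent to its own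
  -- negative, and -7 falls back to 3.
  have h5 : thetaConst (-5) τ = 0 := by
    have : thetaConst (-5) τ = -thetaConst (-5) τ := p5.trans p7
    linear_combination this / 2
  have h7 : thetaConst (-7) τ = -thetaConst 3 τ := by rw [p8, neg_neg]
  have e7 : cexp (Real.pi * I * c * (-7 / 10)) = -cexp (Real.pi * I * c * (3 / 10)) := by
    have h1 : cexp (-Real.pi * I * c) = -1 := by
      rw [show -Real.pi * I * c = ((-c : ℤ) : ℂ) * (Real.pi * I) by push_cast; ring,
        Complex.exp_int_mul, Complex.exp_pi_mul_I, (hc.neg).neg_one_zpow]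
    rw [show Real.pi * I * c * (-7 / 10) = -Real.pi * I * c + Real.pi * I * c * (3 / 10) by ring,
      Complex.exp_add, h1, neg_one_mul]
  rw [Complex.two_cos, Complex.two_cos]
  simp only [Fin.sum_univ_five]
  norm_num [h5, h7, p1, p3]
  ring_nf
  rw [e7]
  ring

/-- Poisson summation, through the functional equation of `jacobiTheta₂`. The root K is common to
all c, and only its square will matter. -/
theorem thetaConst_neg_inv {τ : ℂ} (hτ : 0 < τ.im) : ∃ K : ℂ, K ^ 2 = -I * τ / 5 ∧
    ∀ c : ℤ, Odd c → thetaConst c (-1 / τ) = K *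
      (2 * Complex.cos (Real.pi * c / 10) * thetaConst 1 τ +
        2 * Complex.cos (3 * Real.pi * c / 10) * thetaConst 3 τ) := by
  have hτ0 : τ ≠ 0 := by rintro rfl; simp at hτ
  refine ⟨1 / (-I * (5 * (-1 / τ))) ^ (1 / 2 : ℂ), ?_, fun c hc => ?_⟩
  · rw [div_pow, ← Complex.cpow_nat_mul]
    norm_num
    field_simp
  · rw [← tsum_shift_eq_thetaConst hτ hc, thetaConst_eq_jacobiTheta₂,
      jacobiTheta₂_functional_equation, mul_left_comm, mul_assoc]
    congr 1
    have h2 : -1 / (5 * (-1 / τ)) = τ / 5 := by field_simp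
    have h1 : (1 / 2 - c * (-1 / τ) / 2) / (5 * (-1 / τ)) = -(τ + c) / 10 := by
      field_simp
      ring
    have h3 : -Real.pi * I * (1 / 2 - c * (-1 / τ) / 2) ^ 2 / (5 * (-1 / τ)) =
        Real.pi * I * (τ + 2 * c + c ^ 2 / τ) / 20 := by
      field_simp
      ring
    rw [h1, h2, h3, mul_left_comm, jacobiTheta₂, ← tsum_mul_left, ← tsum_mul_left]
    refine tsum_congr fun n => ?_
    rw [jacobiTheta₂_term, ← Complex.exp_add, ← Complex.exp_add, ← Complex.exp_add]
    congr 1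
    field_simp
    ring

end

/-! ### Icosahedral invariants -/

/-- The vertex form of the icosahedron, of degree `12`. -/
def icosahedralVertexForm (x y : ℂ) : ℂ := x * y * (x ^ 10 - 11 * x ^ 5 * y ^ 5 - y ^ 10)

/-- The face form of the icosahedron, of degree `20`, in terms of the fifth powers. -/
def icosahedralFaceForm (X Y : ℂ) : ℂ :=
  X ^ 4 + 228 * X ^ 3 * Y + 494 * X ^ 2 * Y ^ 2 - 228 * X * Y ^ 3 + Y ^ 4

/-- Fifth powers are reduced to the basis 1, t, so that the invariance of the two forms is checked
by arithmetic on pairs via `golden_mul`. -/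
theorem golden_pow_five_left {t : ℂ} (ht : t ^ 2 = 1 - t) (x y : ℂ) :
    (x + t * y) ^ 5 =
    (x ^ 5 + 10 * x ^ 3 * y ^ 2 - 10 * x ^ 2 * y ^ 3 + 10 * x * y ^ 4 - 3 * y ^ 5) +
      t * (5 * x ^ 4 * y - 10 * x ^ 3 * y ^ 2 + 20 * x ^ 2 * y ^ 3 - 15 * x * y ^ 4 +
        5 * y ^ 5) := by
  have h3 : t ^ 3 = 2 * t - 1 := by linear_combination (t - 1) * ht
  have h4 : t ^ 4 = 2 - 3 * t := by linear_combination t * h3 + 2 * ht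
  have h5 : t ^ 5 = 5 * t - 3 := by linear_combination t * h4 - 3 * ht
  linear_combination 10 * x ^ 3 * y ^ 2 * ht + 10 * x ^ 2 * y ^ 3 * h3 + 5 * x * y ^ 4 * h4 +
    y ^ 5 * h5

theorem golden_pow_five_right {t : ℂ} (ht : t ^ 2 = 1 - t) (x y : ℂ) :
    (t * x - y) ^ 5 =
    (-3 * x ^ 5 - 10 * x ^ 4 * y - 10 * x ^ 3 * y ^ 2 - 10 * x ^ 2 * y ^ 3 - y ^ 5) +
      t * (5 * x ^ 5 + 15 * x ^ 4 * y + 20 * x ^ 3 * y ^ 2 + 10 * x ^ 2 * y ^ 3 +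
        5 * x * y ^ 4) := by
  have h3 : t ^ 3 = 2 * t - 1 := by linear_combination (t - 1) * ht
  have h4 : t ^ 4 = 2 - 3 * t := by linear_combination t * h3 + 2 * ht
  have h5 : t ^ 5 = 5 * t - 3 := by linear_combination t * h4 - 3 * ht
  linear_combination -10 * x ^ 2 * y ^ 3 * ht + 10 * x ^ 3 * y ^ 2 * h3 - 5 * x ^ 4 * y * h4 +
    x ^ 5 * h5

theorem golden_mul {t : ℂ} (ht : t ^ 2 = 1 - t) (a b c d : ℂ) : (a + t * b) * (c + t * d) =
    (a * c + b * d) + t * (a * d + b * c - b * d) := by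
  linear_combination b * d * ht

/-- Invariance of the vertex form under the generator of order two of the icosahedral group. -/
theorem icosahedralVertexForm_golden {t : ℂ} (ht : t ^ 2 = 1 - t) (x y : ℂ) :
    icosahedralVertexForm (x + t * y) (t * x - y) =
    (2 - t) ^ 6 * icosahedralVertexForm x y := by
  have h2 : (2 - t) ^ 2 = 5 - 5 * t := by linear_combination ht
  have h6 : (2 - t) ^ 6 = 625 - 1000 * t := by
    rw [show (2 - t) ^ 6 = ((2 - t) ^ 2) ^ 3 by ring, h2]
    linear_combination (500 - 125 * t) * ht
  have hxy : (x + t * y) * (t * x - y) = 0 + t * (x ^ 2 - x * y - y ^ 2) := by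
    linear_combination x * y * ht
  rw [icosahedralVertexForm, icosahedralVertexForm, hxy, h6,
    show (x + t * y) ^ 10 = (x + t * y) ^ 5 * (x + t * y) ^ 5 by ring,
    show (t * x - y) ^ 10 = (t * x - y) ^ 5 * (t * x - y) ^ 5 by ring,
    mul_assoc 11, golden_pow_five_left ht, golden_pow_five_right ht, mul_sub, mul_sub, mul_left_comm _ 11,
    golden_mul ht, golden_mul ht, golden_mul ht, golden_mul ht, golden_mul ht, golden_mul ht]
  ring

/-- Invariance of the face form under the generator of order two of the icosahedral group. -/
theorem icosahedralFaceForm_golden {t : ℂ} (ht : t ^ 2 = 1 - t) (x y : ℂ) :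
    icosahedralFaceForm ((x + t * y) ^ 5) ((t * x - y) ^ 5) =
    (2 - t) ^ 10 * icosahedralFaceForm (x ^ 5) (y ^ 5) := by
  have h2 : (2 - t) ^ 2 = 5 - 5 * t := by linear_combination ht
  have h6 : (2 - t) ^ 10 = 106250 - 171875 * t := by
    rw [show (2 - t) ^ 10 = ((2 - t) ^ 2) ^ 5 by ring, h2]
    linear_combination (-3125 * t ^ 3 + 18750 * t ^ 2 - 53125 * t + 103125) * ht
  have h4 : ∀ X Y : ℂ, icosahedralFaceForm X Y =
      X * X * (X * X) + 228 * (X * X * (X * Y)) + 494 * (X * Y * (X * Y)) -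
        228 * (X * Y * (Y * Y)) + Y * Y * (Y * Y) := fun X Y => by
    rw [icosahedralFaceForm]; ring
  rw [h6, h4, golden_pow_five_left ht, golden_pow_five_right ht, golden_mul ht, golden_mul ht,
    golden_mul ht, golden_mul ht, golden_mul ht, golden_mul ht, golden_mul ht, golden_mul ht,
    icosahedralFaceForm]
  ring

section

open Complex

/-- Here s = 2cos(π/10) and t = 2cos(π/5) - 1; the relations come from the quadratic equation of
cos(π/5) and the double and triple angle formulas. -/
theorem exists_golden_cos : ∃ s t : ℂ, t ^ 2 = 1 - t ∧ s ^ 2 * (2 - t) = 5 ∧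
    2 * Complex.cos (Real.pi / 10) = s ∧ 2 * Complex.cos (3 * Real.pi / 10) = s * t ∧
      2 * Complex.cos (9 * Real.pi / 10) = -s := by
  have h1 : Complex.cos (Real.pi / 5) = ((Real.cos (Real.pi / 5) : ℝ) : ℂ) := by
    rw [Complex.ofReal_cos]
    push_cast
    rfl
  have h2 : 4 * Complex.cos (Real.pi / 5) ^ 2 - 2 * Complex.cos (Real.pi / 5) - 1 = 0 := by
    have := Real.quadratic_root_cos_pi_div_five
    rw [h1]
    exact_mod_cast this
  have h3 : Complex.cos (Real.pi / 5) = 2 * Complex.cos (Real.pi / 10) ^ 2 - 1 := by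
    rw [← Complex.cos_two_mul]
    congr 1
    ring
  have h4 : Complex.cos (3 * Real.pi / 10) =
      4 * Complex.cos (Real.pi / 10) ^ 3 - 3 * Complex.cos (Real.pi / 10) := by
    rw [← Complex.cos_three_mul]
    congr 1
    ring
  have h5 : Complex.cos (9 * Real.pi / 10) = -Complex.cos (Real.pi / 10) := by
    rw [← Complex.cos_pi_sub]
    congr 1
    ring
  refine ⟨2 * Complex.cos (Real.pi / 10), 2 * Complex.cos (Real.pi / 5) - 1, ?_, ?_, rfl, ?_, ?_⟩
  · linear_combination h2
  · rw [mul_pow, show (2 : ℂ) ^ 2 * Complex.cos (Real.pi / 10) ^ 2 =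
      2 * (Complex.cos (Real.pi / 5) + 1) by rw [h3]; ring]
    linear_combination -h2
  · rw [h4, h3]
    ring
  · rw [h5]
    ring

/-- The inversion `τ ↦ -1 / τ` acts on the two theta constants through the icosahedral group. -/
theorem thetaConst_inversion {τ : ℂ} (hτ : 0 < τ.im) : ∃ L t : ℂ, t ^ 2 = 1 - t ∧
    L ^ 2 * (2 - t) = -I * τ ∧
    thetaConst 1 (-1 / τ) = L * (thetaConst 1 τ + t * thetaConst 3 τ) ∧
    thetaConst 3 (-1 / τ) = L * (t * thetaConst 1 τ - thetaConst 3 τ) := by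
  obtain ⟨K, hK, h⟩ := thetaConst_neg_inv hτ
  obtain ⟨s, t, ht, hs, c1, c3, c9⟩ := exists_golden_cos
  refine ⟨K * s, t, ht, ?_, ?_, ?_⟩
  · rw [mul_pow, hK, mul_assoc, hs]
    ring
  · have h1 := h 1 (by decide)
    push_cast at h1
    rw [mul_one, mul_one, c1, c3] at h1
    rw [h1]
    ring
  · have h1 := h 3 (by decide)
    push_cast at h1
    rw [mul_comm (Real.pi : ℂ) 3, c3, show (3 : ℂ) * Real.pi * 3 / 10 = 9 * Real.pi / 10 by ring,
      c9] at h1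
    rw [h1]
    ring

theorem eta_eq_eulerProd (τ : ℂ) : ModularForm.eta τ =
    cexp (2 * Real.pi * I * τ / 24) * eulerProd (Function.Periodic.qParam 1 τ) := by
  rw [ModularForm.eta, eulerProd]
  simp [Function.Periodic.qParam, ModularForm.eta_q]

/-- The twelfth power removes the square roots from the transformation law; the sign comes from I⁶ =
-1. -/
theorem eta_neg_inv_pow_twelve {τ : ℂ} (hτ : 0 < τ.im) :
    ModularForm.eta (-1 / τ) ^ 12 = -τ ^ 6 * ModularForm.eta τ ^ 12 := by
  have hτ0 : τ ≠ 0 := by rintro rfl; simp at hτ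
  have h := ModularForm.eta_comp_eq_csqrt_I_inv (x := τ) hτ
  simp only [Function.comp, Pi.smul_apply, Pi.mul_apply, smul_eq_mul] at h
  have hsq : ∀ z : ℂ, Complex.sqrt z ^ 12 = z ^ 6 := fun z => by
    rw [Complex.sqrt, show 12 = 2 * 6 by norm_num, pow_mul, ← Complex.cpow_nat_mul]
    norm_num
  rw [h, mul_pow, mul_pow, inv_pow, hsq, hsq, show I ^ 6 = -1 by
    rw [show 6 = 2 * 3 by norm_num, pow_mul, I_sq]; norm_num]
  norm_num

end

/-! ### Level-one modular forms from functions on the disc -/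

/-- The form `B(q)⁵ = (q; q)_∞⁻³ (∑ (-1)ⁿ q ^ ((5n² - n) / 2))⁵` of weight one. -/
noncomputable def quinticBFive (q : ℂ) : ℂ := quinticTheta 1 q ^ 5 / eulerProd q ^ 3

/-- The form `A(q)⁵ = q (q; q)_∞⁻³ (∑ (-1)ⁿ q ^ ((5n² - 3n) / 2))⁵` of weight one. -/
noncomputable def quinticAFive (q : ℂ) : ℂ := q * quinticTheta 3 q ^ 5 / eulerProd q ^ 3

/-- The ratio of the vertex form in the quintic theta functions and `(q; q)_∞ ^ 12`. -/
noncomputable def vertexRatio (q : ℂ) : ℂ :=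
  quinticTheta 1 q * quinticTheta 3 q *
    (quinticTheta 1 q ^ 10 - 11 * quinticTheta 1 q ^ 5 * (q * quinticTheta 3 q ^ 5) -
      (q * quinticTheta 3 q ^ 5) ^ 2) / eulerProd q ^ 12

theorem differentiableOn_quinticBFive : DifferentiableOn ℂ quinticBFive (Metric.ball 0 1) :=
  ((differentiableOn_quinticTheta (by norm_num)).fun_pow 5).fun_div
    (differentiableOn_eulerProd.fun_pow 3)
    fun _ hq => pow_ne_zero _ (eulerProd_ne_zero (by simpa using hq))

theorem differentiableOn_quinticAFive : DifferentiableOn ℂ quinticAFive (Metric.ball 0 1) :=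
  (differentiableOn_id.fun_mul ((differentiableOn_quinticTheta (by norm_num)).fun_pow 5)).fun_div
    (differentiableOn_eulerProd.fun_pow 3)
    fun _ hq => pow_ne_zero _ (eulerProd_ne_zero (by simpa using hq))

theorem differentiableOn_vertexRatio : DifferentiableOn ℂ vertexRatio (Metric.ball 0 1) := by
  have h1 := differentiableOn_quinticTheta (c := 1) (by norm_num)
  have h3 := differentiableOn_quinticTheta (c := 3) (by norm_num)
  refine DifferentiableOn.fun_div (by fun_prop) (differentiableOn_eulerProd.fun_pow 12)
    fun _ hq => pow_ne_zero _ (eulerProd_ne_zero (by simpa using hq))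

section

open Complex hiding eta
open UpperHalfPlane hiding I
open ModularForm
open scoped MatrixGroups Manifold

local notation "qp" => Function.Periodic.qParam 1

theorem norm_qParam_one_lt_one {τ : ℂ} (hτ : 0 < τ.im) : ‖qp τ‖ < 1 :=
  Function.Periodic.norm_qParam_lt_one one_pos hτ

theorem thetaConst_pow_five (τ : ℂ) :
    thetaConst 1 τ ^ 5 = cexp (Real.pi * I * τ / 4) * quinticTheta 1 (qp τ) ^ 5 ∧
    thetaConst 3 τ ^ 5 = cexp (Real.pi * I * τ / 4) * (qp τ * quinticTheta 3 (qp τ) ^ 5) := by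
  rw [thetaConst_eq_quinticTheta (by decide), thetaConst_eq_quinticTheta (by decide), mul_pow,
    mul_pow, ← Complex.exp_nat_mul, ← Complex.exp_nat_mul, qParam_one_eq]
  constructor
  · congr 2
    push_cast
    ring
  · rw [← mul_assoc (cexp (Real.pi * I * τ / 4)), ← Complex.exp_add]
    congr 2
    push_cast
    ring

theorem thetaConst_one_mul_three (τ : ℂ) : thetaConst 1 τ * thetaConst 3 τ =
    cexp (Real.pi * I * τ / 4) ^ 2 * (quinticTheta 1 (qp τ) * quinticTheta 3 (qp τ)) := by
  rw [thetaConst_eq_quinticTheta (by decide), thetaConst_eq_quinticTheta (by decide),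
    mul_mul_mul_comm, ← Complex.exp_add, ← Complex.exp_nat_mul]
  congr 2
  push_cast
  ring

theorem eta_pow_twelve (τ : ℂ) :
    eta τ ^ 12 = cexp (Real.pi * I * τ / 4) ^ 4 * eulerProd (qp τ) ^ 12 := by
  rw [eta_eq_eulerProd, mul_pow, ← Complex.exp_nat_mul, ← Complex.exp_nat_mul]
  congr 2
  push_cast
  ring

theorem vertexRatio_qParam {τ : ℂ} (hτ : 0 < τ.im) : vertexRatio (qp τ) =
    icosahedralVertexForm (thetaConst 1 τ) (thetaConst 3 τ) / eta τ ^ 12 := by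
  obtain ⟨h1, h3⟩ := thetaConst_pow_five τ
  have hE := eulerProd_ne_zero (norm_qParam_one_lt_one hτ)
  have hw := Complex.exp_ne_zero (Real.pi * I * τ / 4)
  rw [icosahedralVertexForm, thetaConst_one_mul_three,
    show thetaConst 1 τ ^ 10 = (thetaConst 1 τ ^ 5) ^ 2 by ring,
    show thetaConst 3 τ ^ 10 = (thetaConst 3 τ ^ 5) ^ 2 by ring, h1, h3, eta_pow_twelve,
    vertexRatio]
  field_simp

theorem faceForm_qParam {τ : ℂ} (hτ : 0 < τ.im) :
    icosahedralFaceForm (quinticBFive (qp τ)) (quinticAFive (qp τ)) =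
      icosahedralFaceForm (thetaConst 1 τ ^ 5) (thetaConst 3 τ ^ 5) / eta τ ^ 12 := by
  obtain ⟨h1, h3⟩ := thetaConst_pow_five τ
  have hE := eulerProd_ne_zero (norm_qParam_one_lt_one hτ)
  have hw := Complex.exp_ne_zero (Real.pi * I * τ / 4)
  rw [icosahedralFaceForm, icosahedralFaceForm, h1, h3, eta_pow_twelve, quinticBFive, quinticAFive]
  field_simp

theorem im_neg_inv_pos {τ : ℂ} (hτ : 0 < τ.im) : 0 < (-1 / τ).im := by
  have hτ0 : τ ≠ 0 := by rintro rfl; simp at hτ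
  rw [neg_div, one_div, Complex.neg_im, Complex.inv_im, neg_div, neg_neg]
  exact div_pos hτ (normSq_pos.mpr hτ0)

theorem vertexRatio_neg_inv {τ : ℂ} (hτ : 0 < τ.im) :
    vertexRatio (qp (-1 / τ)) = vertexRatio (qp τ) := by
  obtain ⟨L, t, ht, hL, h1, h3⟩ := thetaConst_inversion hτ
  have hτ0 : τ ≠ 0 := by rintro rfl; simp at hτ
  have he := eta_ne_zero (z := τ) hτ
  have hhom : ∀ x y : ℂ, icosahedralVertexForm (L * x) (L * y) =
      L ^ 12 * icosahedralVertexForm x y := fun x y => by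
    simp only [icosahedralVertexForm]; ring
  rw [vertexRatio_qParam (im_neg_inv_pos hτ), vertexRatio_qParam hτ, h1, h3, hhom,
    icosahedralVertexForm_golden ht, eta_neg_inv_pow_twelve hτ, ← mul_assoc,
    show L ^ 12 * (2 - t) ^ 6 = (L ^ 2 * (2 - t)) ^ 6 by ring, hL,
    show (-I * τ) ^ 6 = -τ ^ 6 by
      rw [mul_pow, neg_pow, show I ^ 6 = (I ^ 2) ^ 3 by ring, I_sq]; ring]
  field_simp

theorem faceForm_neg_inv {τ : ℂ} (hτ : 0 < τ.im) :
    icosahedralFaceForm (quinticBFive (qp (-1 / τ))) (quinticAFive (qp (-1 / τ))) =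
      τ ^ 4 * icosahedralFaceForm (quinticBFive (qp τ)) (quinticAFive (qp τ)) := by
  obtain ⟨L, t, ht, hL, h1, h3⟩ := thetaConst_inversion hτ
  have hτ0 : τ ≠ 0 := by rintro rfl; simp at hτ
  have he := eta_ne_zero (z := τ) hτ
  have hhom : ∀ x y : ℂ, icosahedralFaceForm (L ^ 5 * x) (L ^ 5 * y) =
      L ^ 20 * icosahedralFaceForm x y := fun x y => by
    simp only [icosahedralFaceForm]; ring
  rw [faceForm_qParam (im_neg_inv_pos hτ), faceForm_qParam hτ, h1, h3, mul_pow, mul_pow, hhom,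
    icosahedralFaceForm_golden ht, eta_neg_inv_pow_twelve hτ, ← mul_assoc,
    show L ^ 20 * (2 - t) ^ 10 = (L ^ 2 * (2 - t)) ^ 10 by ring, hL,
    show (-I * τ) ^ 10 = -τ ^ 10 by
      rw [mul_pow, neg_pow, show I ^ 10 = (I ^ 2) ^ 5 by ring, I_sq]; ring]
  field_simp

/-- A holomorphic function on the unit disc that satisfies the transformation law under
`τ ↦ -1 / τ` gives a modular form of level one. -/
theorem exists_modularForm_of_disc {k : ℤ} {G : ℂ → ℂ}
    (hG : DifferentiableOn ℂ G (Metric.ball 0 1))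
    (hS : ∀ τ : ℂ, 0 < τ.im → G (qp (-1 / τ)) = τ ^ k * G (qp τ)) :
    ∃ f : ModularForm 𝒮ℒ k, ∀ τ : ℍ, f τ = G (qp τ) := by
  have hSl : (fun τ : ℍ => G (qp τ)) ∣[k] ModularGroup.S = fun τ : ℍ => G (qp τ) := by
    ext z
    have hz : (z : ℂ) ≠ 0 := z.ne_zero
    have h := hS z z.im_pos
    rw [SL_slash_apply, UpperHalfPlane.modular_S_smul, ModularGroup.denom_S]
    rw [neg_div, one_div, ← inv_neg] at h
    simp only [h]
    rw [mul_right_comm, ← zpow_add₀ hz, add_neg_cancel, zpow_zero, one_mul]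
  have hTl : (fun τ : ℍ => G (qp τ)) ∣[k] ModularGroup.T = fun τ : ℍ => G (qp τ) := by
    ext z
    have h1 : denom ModularGroup.T z = 1 := by
      rw [ModularGroup.denom_apply]
      simp [ModularGroup.T]
    have h : qp (1 + (z : ℂ)) = qp z := by
      rw [qParam_one_eq, qParam_one_eq, mul_add, Complex.exp_add, mul_one,
        Complex.exp_two_pi_mul_I, one_mul]
    rw [SL_slash_apply, modular_T_smul, h1]
    simp [h]
  have hSL := SlashInvariantForm.slash_action_generators_SL2Z hSl hTl
  have hball : ∀ z : ℂ, 0 < z.im → DifferentiableAt ℂ G (qp z) := fun z hz =>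
    hG.differentiableAt (Metric.isOpen_ball.mem_nhds (by simpa using norm_qParam_one_lt_one hz))
  refine ⟨{ toFun := fun τ : ℍ => G (qp τ), slash_action_eq' := ?_, holo' := ?_,
            bdd_at_cusps' := ?_ }, fun τ => rfl⟩
  · rintro A ⟨A, rfl⟩
    exact hSL A
  · rw [UpperHalfPlane.mdifferentiable_iff]
    refine DifferentiableOn.congr (f := fun z => G (qp z)) (fun z hz => ?_) fun z hz => ?_
    · exact ((hball z hz).comp z (by fun_prop)).differentiableWithinAt
    · simp [ofComplex_apply_of_im_pos hz]
  · intro c hc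
    rw [Subgroup.IsArithmetic.isCusp_iff_isCusp_SL2Z] at hc
    rw [OnePoint.isBoundedAt_iff_forall_SL2Z hc]
    intro γ _
    rw [hSL]
    -- By invariance every cusp reduces to i∞, where q tends to 0 and G is continuous.
    have h0 : ContinuousAt G 0 :=
      (hG.differentiableAt (Metric.isOpen_ball.mem_nhds (by simp))).continuousAt
    exact (h0.tendsto.comp (qParam_tendsto_atImInfty one_pos)).isBigO_one ℝ

/-- Two analytic functions on the unit disc agree if they agree as functions of `τ`. -/
theorem eqOn_disc_of_qParam {F G : ℂ → ℂ} (hF : DifferentiableOn ℂ F (Metric.ball 0 1))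
    (hG : DifferentiableOn ℂ G (Metric.ball 0 1)) {c : ℂ}
    (h : ∀ τ : ℍ, c * F (qp τ) = G (qp τ)) (h0 : F 0 = G 0) (hne : G 0 ≠ 0) {q : ℂ}
    (hq : ‖q‖ < 1) : F q = G q := by
  have hmem := Metric.isOpen_ball.mem_nhds (Metric.mem_ball_self (x := (0 : ℂ)) one_pos)
  have hcF := (hF.differentiableAt hmem).continuousAt.tendsto.const_mul c
  have hcG := (hG.differentiableAt hmem).continuousAt.tendsto
  have t1 := hcF.comp (qParam_tendsto_atImInfty one_pos)
  have t2 := hcG.comp (qParam_tendsto_atImInfty one_pos)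
  -- Letting q tend to 0 forces the unknown constant to be 1.
  have hc : c * F 0 = G 0 := tendsto_nhds_unique t1 (t2.congr fun τ => (h τ).symm)
  have hc1 : c = 1 := by
    rw [h0] at hc
    exact mul_right_cancel₀ hne (hc.trans (one_mul _).symm)
  rcases eq_or_ne q 0 with rfl | hq0
  · exact h0
  · have := h ⟨_, Function.Periodic.im_invQParam_pos_of_norm_lt_one one_pos hq hq0⟩
    simpa [hc1, Function.Periodic.qParam_right_inv one_ne_zero hq0] using this

/-- The vertex form in the quintic theta functions is `(q; q)_∞ ^ 12`. -/
theorem vertexRatio_eq_one {q : ℂ} (hq : ‖q‖ < 1) : vertexRatio q = 1 := by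
  have hd := differentiableOn_vertexRatio
  obtain ⟨f, hf⟩ := exists_modularForm_of_disc (k := 0) hd fun τ hτ => by
    rw [vertexRatio_neg_inv hτ, zpow_zero, one_mul]
  obtain ⟨c, hc⟩ := ModularFormClass.levelOne_weight_zero_const f
  refine (eqOn_disc_of_qParam (F := fun _ => 1) (c := c) (differentiableOn_const _) hd
    (fun τ => ?_) ?_ ?_ hq).symm
  · rw [← hf, hc]
    simp
  · simp [vertexRatio, quinticTheta_zero, eulerProd_zero]
  · simp [vertexRatio, quinticTheta_zero, eulerProd_zero]

end

/-! ### The Eisenstein series as the face form -/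

/-- The Eisenstein series of weight four, as a function on the unit disc. -/
noncomputable def eisensteinFour (q : ℂ) : ℂ :=
  1 + 240 * ∑' k : ℕ, (∑ d ∈ (k + 1).divisors, (d : ℂ) ^ 3) * q ^ (k + 1)

theorem norm_sum_divisors_le (k : ℕ) : ‖∑ d ∈ k.divisors, (d : ℂ) ^ 3‖ ≤ (k : ℝ) ^ 4 := by
  have h := ArithmeticFunction.sigma_le_pow_succ 3 k
  rw [ArithmeticFunction.sigma_apply] at h
  have h2 : (∑ d ∈ k.divisors, (d : ℂ) ^ 3) = ((∑ d ∈ k.divisors, d ^ 3 : ℕ) : ℂ) := by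
    push_cast; rfl
  rw [h2, Complex.norm_natCast]
  exact_mod_cast h

theorem summable_sigma_bound {r : ℝ} (h0 : 0 ≤ r) (hr : r < 1) :
    Summable fun k : ℕ => ((k + 1 : ℕ) : ℝ) ^ 4 * r ^ (k + 1) :=
  (summable_nat_add_iff (f := fun k : ℕ => (k : ℝ) ^ 4 * r ^ k) 1).mpr
    (summable_pow_mul_geometric_of_norm_lt_one 4 (by rwa [Real.norm_of_nonneg h0]))

theorem summable_eisensteinFour {q : ℂ} (hq : ‖q‖ < 1) :
    Summable fun k : ℕ => (∑ d ∈ (k + 1).divisors, (d : ℂ) ^ 3) * q ^ (k + 1) := by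
  refine Summable.of_norm_bounded (summable_sigma_bound (norm_nonneg q) hq) fun k => ?_
  rw [norm_mul, norm_pow]
  gcongr
  exact norm_sum_divisors_le _

theorem differentiableOn_eisensteinFour : DifferentiableOn ℂ eisensteinFour (Metric.ball 0 1) := by
  intro q hq
  obtain ⟨r, hqr, hr⟩ := exists_between (mem_ball_zero_iff.mp hq)
  have h : DifferentiableOn ℂ (fun q : ℂ => ∑' k : ℕ, (∑ d ∈ (k + 1).divisors, (d : ℂ) ^ 3) *
      q ^ (k + 1)) (Metric.ball 0 r) := by
    refine Complex.differentiableOn_tsum_of_summable_norm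
      (summable_sigma_bound ((norm_nonneg q).trans hqr.le) hr) (fun n => by fun_prop)
      Metric.isOpen_ball fun n w hw => ?_
    rw [norm_mul, norm_pow]
    gcongr
    · exact norm_sum_divisors_le _
    · exact (mem_ball_zero_iff.mp hw).le
  have h2 := h.differentiableAt (Metric.isOpen_ball.mem_nhds (by simpa using hqr))
  exact ((h2.const_mul 240).const_add 1).differentiableWithinAt

section

open Complex hiding eta
open UpperHalfPlane hiding I
open ModularForm
open scoped MatrixGroups

local notation "qp" => Function.Periodic.qParam 1

theorem E₄_eq_eisensteinFour (τ : ℍ) : E₄ τ = eisensteinFour (qp τ) := by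
  have h := EisensteinSeries.q_expansion_bernoulli (by norm_num : 3 ≤ 4) ⟨2, rfl⟩ τ
  -- The constant 240 is -8/B₄.
  have hb : bernoulli 4 = -1 / 30 := by decide +kernel
  rw [h, eisensteinFour, hb, ← qParam_one_eq]
  simp_rw [zpow_natCast]
  rw [tsum_pnat_eq_tsum_succ (f := fun n : ℕ =>
    ((ArithmeticFunction.sigma (4 - 1) n : ℕ) : ℂ) * qp τ ^ n)]
  simp_rw [ArithmeticFunction.sigma_apply]
  push_cast
  norm_num

/-- Klein's expression of the Eisenstein series of weight four as the face form. -/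
theorem faceForm_eq_eisensteinFour {q : ℂ} (hq : ‖q‖ < 1) :
    icosahedralFaceForm (quinticBFive q) (quinticAFive q) = eisensteinFour q := by
  have hd : DifferentiableOn ℂ (fun q => icosahedralFaceForm (quinticBFive q) (quinticAFive q))
      (Metric.ball 0 1) := by
    have h1 := differentiableOn_quinticBFive
    have h2 := differentiableOn_quinticAFive
    simp only [icosahedralFaceForm]
    fun_prop
  obtain ⟨f, hf⟩ := exists_modularForm_of_disc (k := 4) hd fun τ hτ => by
    exact_mod_cast faceForm_neg_inv hτ
  obtain ⟨c, hc⟩ := (finrank_eq_one_iff_of_nonzero' (E₄ : ModularForm 𝒮ℒ 4)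
    (EisensteinSeries.E_ne_zero (by norm_num) ⟨2, rfl⟩)).mp
    (Module.rank_eq_one_iff_finrank_eq_one.mp levelOne_weight_four_rank_one) f
  refine (eqOn_disc_of_qParam (c := c) differentiableOn_eisensteinFour hd (fun τ => ?_) ?_ ?_
    hq).symm
  · rw [← hf, ← hc, ← E₄_eq_eisensteinFour]
    rfl
  all_goals simp [icosahedralFaceForm, quinticBFive, quinticAFive, quinticTheta_zero,
    eulerProd_zero, eisensteinFour]

end

/-! ### Quintic transformation -/

/-- The quintic form expressing `B(q)⁵` through the values of the theta series at `q⁵`. -/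
def fifthRootFormB (x y : ℂ) : ℂ :=
  x ^ 5 + 3 * x ^ 4 * y + 4 * x ^ 3 * y ^ 2 + 2 * x ^ 2 * y ^ 3 + x * y ^ 4

/-- The quintic form expressing `A(q)⁵` through the values of the theta series at `q⁵`. -/
def fifthRootFormA (x y : ℂ) : ℂ :=
  x ^ 4 * y - 2 * x ^ 3 * y ^ 2 + 4 * x ^ 2 * y ^ 3 - 3 * x * y ^ 4 + y ^ 5

/-- With `fifthRootForm_quadratic`, this expresses XY and X² - 11XY - Y² for the two quintic forms
X, Y through quantities already known as Euler products. -/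
theorem fifthRootForm_mul (x y : ℂ) :
    fifthRootFormB x y * fifthRootFormA x y * (x ^ 2 - x * y - y ^ 2) =
      x * y * (x ^ 10 - 11 * x ^ 5 * y ^ 5 - (y ^ 5) ^ 2) := by
  simp only [fifthRootFormB, fifthRootFormA]
  ring

theorem fifthRootForm_quadratic (x y : ℂ) :
    fifthRootFormB x y ^ 2 - 11 * (fifthRootFormB x y * fifthRootFormA x y) -
      fifthRootFormA x y ^ 2 = (x ^ 2 - x * y - y ^ 2) ^ 5 := by
  simp only [fifthRootFormB, fifthRootFormA]
  ring

theorem norm_pow_five_lt_one {q : ℂ} (hq : ‖q‖ < 1) : ‖q ^ 5‖ < 1 := by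
  rw [norm_pow]
  exact pow_lt_one₀ (norm_nonneg q) hq (by norm_num)

theorem quinticTheta_vertex {q : ℂ} (hq : ‖q‖ < 1) :
    quinticTheta 1 q ^ 10 - 11 * quinticTheta 1 q ^ 5 * (q * quinticTheta 3 q ^ 5) -
      (q * quinticTheta 3 q ^ 5) ^ 2 = eulerProd q ^ 11 / eulerProd (q ^ 5) := by
  have h1 := vertexRatio_eq_one hq
  have h2 := quinticTheta_mul hq
  have hE := eulerProd_ne_zero hq
  have hE5 := eulerProd_ne_zero (norm_pow_five_lt_one hq)
  rw [vertexRatio, div_eq_one_iff_eq (pow_ne_zero _ hE), mul_comm (quinticTheta 1 q), h2] at h1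
  rw [eq_div_iff hE5]
  apply mul_left_cancel₀ hE
  linear_combination h1

theorem quinticBFive_mul_quinticAFive {q : ℂ} (hq : ‖q‖ < 1) :
    quinticBFive q * quinticAFive q = q * eulerProd (q ^ 5) ^ 5 / eulerProd q := by
  have h2 := quinticTheta_mul hq
  have hE := eulerProd_ne_zero hq
  have h3 : quinticBFive q * quinticAFive q =
      q * (quinticTheta 3 q * quinticTheta 1 q) ^ 5 / eulerProd q ^ 6 := by
    rw [quinticBFive, quinticAFive]
    field_simp
  rw [h3, h2]
  field_simp

theorem quinticBFive_quadratic {q : ℂ} (hq : ‖q‖ < 1) :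
    quinticBFive q ^ 2 - 11 * (quinticBFive q * quinticAFive q) - quinticAFive q ^ 2 =
      eulerProd q ^ 5 / eulerProd (q ^ 5) := by
  have hE := eulerProd_ne_zero hq
  have hE5 := eulerProd_ne_zero (norm_pow_five_lt_one hq)
  have h3 : quinticBFive q ^ 2 - 11 * (quinticBFive q * quinticAFive q) - quinticAFive q ^ 2 =
      (quinticTheta 1 q ^ 10 - 11 * quinticTheta 1 q ^ 5 * (q * quinticTheta 3 q ^ 5) -
        (q * quinticTheta 3 q ^ 5) ^ 2) / eulerProd q ^ 6 := by
    rw [quinticBFive, quinticAFive]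
    field_simp
  rw [h3, quinticTheta_vertex hq]
  field_simp

theorem quinticTheta_quadratic {q : ℂ} (hq : ‖q‖ < 1) :
    quinticTheta 1 (q ^ 5) ^ 2 - quinticTheta 1 (q ^ 5) * (q * quinticTheta 3 (q ^ 5)) -
      (q * quinticTheta 3 (q ^ 5)) ^ 2 = eulerProd q * eulerProd (q ^ 5) := by
  rw [← quinticTheta_mul hq, quinticTheta_mul_dissection hq]
  ring

theorem fifthRootForm_mul_eq {q : ℂ} (hq : ‖q‖ < 1) :
    fifthRootFormB (quinticTheta 1 (q ^ 5)) (q * quinticTheta 3 (q ^ 5)) *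
      fifthRootFormA (quinticTheta 1 (q ^ 5)) (q * quinticTheta 3 (q ^ 5)) =
      q * eulerProd (q ^ 5) ^ 11 / eulerProd q := by
  have hq5 := norm_pow_five_lt_one hq
  have hE := eulerProd_ne_zero hq
  have hE5 := eulerProd_ne_zero hq5
  have hE25 := eulerProd_ne_zero (norm_pow_five_lt_one hq5)
  have h1 := fifthRootForm_mul (quinticTheta 1 (q ^ 5)) (q * quinticTheta 3 (q ^ 5))
  rw [quinticTheta_quadratic hq, mul_pow q, quinticTheta_vertex hq5,
    mul_left_comm (quinticTheta 1 (q ^ 5)),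
    mul_comm (quinticTheta 1 (q ^ 5)) (quinticTheta 3 (q ^ 5)), quinticTheta_mul hq5] at h1
  rw [eq_div_iff hE]
  apply mul_right_cancel₀ hE5
  rw [mul_assoc, h1]
  generalize eulerProd ((q ^ 5) ^ 5) = e at hE25
  field_simp

theorem fifthRootForm_quadratic_eq {q : ℂ} (hq : ‖q‖ < 1) :
    fifthRootFormB (quinticTheta 1 (q ^ 5)) (q * quinticTheta 3 (q ^ 5)) ^ 2 -
      11 * (fifthRootFormB (quinticTheta 1 (q ^ 5)) (q * quinticTheta 3 (q ^ 5)) *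
        fifthRootFormA (quinticTheta 1 (q ^ 5)) (q * quinticTheta 3 (q ^ 5))) -
      fifthRootFormA (quinticTheta 1 (q ^ 5)) (q * quinticTheta 3 (q ^ 5)) ^ 2 =
      (eulerProd q * eulerProd (q ^ 5)) ^ 5 := by
  rw [fifthRootForm_quadratic, quinticTheta_quadratic hq]

theorem differentiableOn_comp_pow_five {f : ℂ → ℂ}
    (hf : DifferentiableOn ℂ f (Metric.ball 0 1)) :
    DifferentiableOn ℂ (fun q => f (q ^ 5)) (Metric.ball 0 1) :=
  hf.comp (by fun_prop) fun q hq => by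
    simpa using norm_pow_five_lt_one (mem_ball_zero_iff.mp hq)

/-- The quintic transformation of the theta functions: `A(q)⁵` and `B(q)⁵` are quintic forms in
the theta series at `q⁵`. -/
theorem quintic_transformation {q : ℂ} (hq : ‖q‖ < 1) :
    quinticBFive q = fifthRootFormB (quinticTheta 1 (q ^ 5)) (q * quinticTheta 3 (q ^ 5)) /
        eulerProd (q ^ 5) ^ 3 ∧
      quinticAFive q = fifthRootFormA (quinticTheta 1 (q ^ 5)) (q * quinticTheta 3 (q ^ 5)) /
        eulerProd (q ^ 5) ^ 3 := by
  set fB : ℂ → ℂ := fun q => fifthRootFormB (quinticTheta 1 (q ^ 5))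
    (q * quinticTheta 3 (q ^ 5)) / eulerProd (q ^ 5) ^ 3 with hfB
  set fA : ℂ → ℂ := fun q => fifthRootFormA (quinticTheta 1 (q ^ 5))
    (q * quinticTheta 3 (q ^ 5)) / eulerProd (q ^ 5) ^ 3 with hfA
  have d1 := differentiableOn_comp_pow_five (differentiableOn_quinticTheta (c := 1) (by norm_num))
  have d3 := differentiableOn_comp_pow_five (differentiableOn_quinticTheta (c := 3) (by norm_num))
  have dE := differentiableOn_comp_pow_five differentiableOn_eulerProd
  have hE : ∀ q ∈ Metric.ball (0 : ℂ) 1, eulerProd (q ^ 5) ^ 3 ≠ 0 := fun q hq =>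
    pow_ne_zero _ (eulerProd_ne_zero (norm_pow_five_lt_one (mem_ball_zero_iff.mp hq)))
  have dfB : DifferentiableOn ℂ fB (Metric.ball 0 1) := by
    refine DifferentiableOn.fun_div ?_ (dE.fun_pow 3) hE
    simp only [fifthRootFormB]
    fun_prop
  have dfA : DifferentiableOn ℂ fA (Metric.ball 0 1) := by
    refine DifferentiableOn.fun_div ?_ (dE.fun_pow 3) hE
    simp only [fifthRootFormA]
    fun_prop
  have hmul : ∀ q : ℂ, ‖q‖ < 1 → quinticBFive q * quinticAFive q = fB q * fA q := by
    intro q hq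
    have hE := eulerProd_ne_zero hq
    have hE5 := eulerProd_ne_zero (norm_pow_five_lt_one hq)
    rw [quinticBFive_mul_quinticAFive hq, hfB, hfA, div_mul_div_comm, fifthRootForm_mul_eq hq]
    field_simp
  have hsub : ∀ q : ℂ, ‖q‖ < 1 →
      quinticBFive q ^ 2 - quinticAFive q ^ 2 = fB q ^ 2 - fA q ^ 2 := by
    intro q hq
    have hE := eulerProd_ne_zero hq
    have hE5 := eulerProd_ne_zero (norm_pow_five_lt_one hq)
    have h1 := quinticBFive_quadratic hq
    have h2 : fB q ^ 2 - 11 * (fB q * fA q) - fA q ^ 2 = eulerProd q ^ 5 / eulerProd (q ^ 5) := by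
      have h3 := fifthRootForm_quadratic_eq hq
      simp only [hfB, hfA]
      rw [show eulerProd q ^ 5 / eulerProd (q ^ 5) =
        (eulerProd q * eulerProd (q ^ 5)) ^ 5 / eulerProd (q ^ 5) ^ 6 by field_simp, ← h3]
      field_simp
    linear_combination h1 - h2 + 11 * hmul q hq
  have hB0 : quinticBFive 0 = 1 := by simp [quinticBFive, quinticTheta_zero, eulerProd_zero]
  have hA0 : quinticAFive 0 = 0 := by simp [quinticAFive]
  have hfB0 : fB 0 = 1 := by simp [hfB, fifthRootFormB, quinticTheta_zero, eulerProd_zero]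
  have hfA0 : fA 0 = 0 := by simp [hfA, fifthRootFormA]
  -- XY and X² - Y² determine (X + iY)² = X² - Y² + 2iXY. The sign of the root is fixed at q = 0,
  -- and taking both i and -i separates X from Y.
  have key : ∀ i : ℂ, i ^ 2 = -1 →
      quinticBFive q + i * quinticAFive q = fB q + i * fA q := by
    intro i hi
    refine eqOn_of_sq_eq_sq (f := fun q => quinticBFive q + i * quinticAFive q)
      (g := fun q => fB q + i * fA q)
      (differentiableOn_quinticBFive.fun_add (differentiableOn_quinticAFive.const_mul i))
      (dfB.fun_add (dfA.const_mul i)) (fun q hq => ?_) ?_ ?_ hq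
    · linear_combination hsub q hq + 2 * i * hmul q hq +
        (quinticAFive q ^ 2 - fA q ^ 2) * hi
    · simp only [hB0, hA0, hfB0, hfA0]
    · simp [hfB0, hfA0]
  have k1 := key Complex.I Complex.I_sq
  have k2 := key (-Complex.I) (by rw [neg_sq, Complex.I_sq])
  constructor
  · linear_combination (k1 + k2) / 2
  · apply mul_left_cancel₀ Complex.I_ne_zero
    linear_combination (k1 - k2) / 2

/-! ### Averaging over fifth roots of unity -/

/-- In this and the next four expansions, the entries at positions 0, 5, 10, 15, 20 form one column
of `quinticMatrix`. -/
theorem fifthRootForm_expand_pow_four_left (x y : ℂ) : fifthRootFormB x y ^ 4 =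
    ∑ k : Fin 21, (![1, 12, 70, 260, 685, 1356, 2092, 2580, 2590, 2140, 1462, 824, 380, 140, 40, 8, 1, 0,
      0, 0, 0] k * x ^ (20 - k.val)) * y ^ k.val := by
  simp [Fin.sum_univ_succ, fifthRootFormB]
  ring

theorem fifthRootForm_expand_pow_three_left (x y : ℂ) : fifthRootFormB x y ^ 3 * fifthRootFormA x y =
    ∑ k : Fin 21, (![0, 1, 7, 25, 60, 115, 186, 247, 250, 190, 110, 57, 29, 25, 15, 10, 3, 1, 0, 0, 0] k * x ^ (20 - k.val)) * y ^ k.val := by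
  simp [Fin.sum_univ_succ, fifthRootFormB, fifthRootFormA]
  ring

theorem fifthRootForm_expand_sq_sq (x y : ℂ) : fifthRootFormB x y ^ 2 * fifthRootFormA x y ^ 2 =
    ∑ k : Fin 21, (![0, 0, 1, 2, 5, 10, 20, 16, 27, 20, 15, -20, 27, -16, 20, -10, 5, -2, 1, 0, 0] k * x ^ (20 - k.val)) * y ^ k.val := by
  simp [Fin.sum_univ_succ, fifthRootFormB, fifthRootFormA]
  ring

theorem fifthRootForm_expand_pow_three_right (x y : ℂ) : fifthRootFormB x y * fifthRootFormA x y ^ 3 =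
    ∑ k : Fin 21, (![0, 0, 0, 1, -3, 10, -15, 25, -29, 57, -110, 190, -250, 247, -186, 115, -60, 25, -7,
      1, 0] k * x ^ (20 - k.val)) * y ^ k.val := by
  simp [Fin.sum_univ_succ, fifthRootFormB, fifthRootFormA]
  ring

theorem fifthRootForm_expand_pow_four_right (x y : ℂ) : fifthRootFormA x y ^ 4 =
    ∑ k : Fin 21, (![0, 0, 0, 0, 1, -8, 40, -140, 380, -824, 1462, -2140, 2590, -2580, 2092, -1356, 685,
      -260, 70, -12, 1] k * x ^ (20 - k.val)) * y ^ k.val := by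
  simp [Fin.sum_univ_succ, fifthRootFormA]
  ring

/-- The quartic form with coefficient vector `v`. -/
def quarticForm (v : Fin 5 → ℂ) (X Y : ℂ) : ℂ :=
  v 0 * X ^ 4 + v 1 * (X ^ 3 * Y) + v 2 * (X ^ 2 * Y ^ 2) + v 3 * (X * Y ^ 3) + v 4 * Y ^ 4

theorem sum_fifth_roots_pow {z : ℂ} (hz : IsPrimitiveRoot z 5) (q : ℂ) (k : ℕ) :
    ∑ j ∈ Finset.range 5, (z ^ j * q) ^ k = if 5 ∣ k then 5 * q ^ k else 0 := by
  have h : ∀ j, (z ^ j * q) ^ k = (z ^ k) ^ j * q ^ k := fun j => by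
    rw [mul_pow, ← pow_mul, ← pow_mul, mul_comm j k]
  simp_rw [h, ← Finset.sum_mul]
  split_ifs with hk
  · rw [(hz.pow_eq_one_iff_dvd k).mpr hk]
    simp
  · have h1 : z ^ k ≠ 1 := fun h => hk ((hz.pow_eq_one_iff_dvd k).mp h)
    rw [geom_sum_eq h1, ← pow_mul, mul_comm k 5, pow_mul, hz.pow_eq_one, one_pow, sub_self,
      zero_div, zero_mul]

theorem sum_fifth_roots_polynomial {z : ℂ} (hz : IsPrimitiveRoot z 5) (c : Fin 21 → ℂ) (s : ℂ) :
    ∑ j ∈ Finset.range 5, ∑ k : Fin 21, c k * (z ^ j * s) ^ k.val =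
      5 * (c 0 + c 5 * s ^ 5 + c 10 * s ^ 10 + c 15 * s ^ 15 + c 20 * s ^ 20) := by
  rw [Finset.sum_comm]
  simp_rw [← Finset.mul_sum, sum_fifth_roots_pow hz]
  simp only [Fin.sum_univ_succ]
  simp [Fin.succ]
  ring

/-- Averaging a quartic form in `B(q)⁵`, `A(q)⁵` over the fifth roots of unity. -/
theorem sum_fifth_roots_quarticForm {z : ℂ} (hz : IsPrimitiveRoot z 5) (v : Fin 5 → ℂ) (x s : ℂ) :
    ∑ j ∈ Finset.range 5,
      quarticForm v (fifthRootFormB x (z ^ j * s)) (fifthRootFormA x (z ^ j * s)) =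
      5 * quarticForm ![v 0, 1356 * v 0 + 115 * v 1 + 10 * v 2 + 10 * v 3 - 8 * v 4,
        1462 * v 0 + 110 * v 1 + 15 * v 2 - 110 * v 3 + 1462 * v 4,
        8 * v 0 + 10 * v 1 - 10 * v 2 + 115 * v 3 - 1356 * v 4, v 4] (x ^ 5) (s ^ 5) := by
  simp only [quarticForm, Finset.sum_add_distrib, ← Finset.mul_sum,
    fifthRootForm_expand_pow_four_left, fifthRootForm_expand_pow_three_left,
    fifthRootForm_expand_sq_sq, fifthRootForm_expand_pow_three_right,
    fifthRootForm_expand_pow_four_right]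
  rw [sum_fifth_roots_polynomial hz, sum_fifth_roots_polynomial hz, sum_fifth_roots_polynomial hz,
    sum_fifth_roots_polynomial hz, sum_fifth_roots_polynomial hz]
  simp
  ring

/-! ### The functions F_n -/

theorem qPochhammerInf_self (q : ℂ) : qPochhammerInf q q = eulerProd q := by
  simp only [qPochhammerInf, eulerProd, pow_succ']

/-- Taking the fifth power turns the principal power into the integer power -3, so no branch is
left. -/
theorem quinticB_pow_five (q : ℂ) : quinticB q ^ 5 = quinticBFive q := by
  rw [quinticB, quinticBFive, mul_pow, ← Complex.cpow_nat_mul, qPochhammerInf_self,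
    show ((5 : ℕ) : ℂ) * (-3 / 5) = ((-3 : ℤ) : ℂ) by push_cast; ring, Complex.cpow_intCast,
    zpow_neg, mul_comm, div_eq_mul_inv, quinticTheta]
  simp only [one_mul]
  rfl

theorem quinticA_pow_five (q : ℂ) : quinticA q ^ 5 = quinticAFive q := by
  rw [quinticA, quinticAFive, mul_pow, mul_pow, ← Complex.cpow_nat_mul, ← Complex.cpow_nat_mul,
    qPochhammerInf_self, show ((5 : ℕ) : ℂ) * (-3 / 5) = ((-3 : ℤ) : ℂ) by push_cast; ring,
    show ((5 : ℕ) : ℂ) * (1 / 5) = 1 by push_cast; ring, Complex.cpow_one, Complex.cpow_intCast,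
    zpow_neg, mul_right_comm, div_eq_mul_inv, quinticTheta]
  rfl

theorem quinticF_eq_quarticForm (n : ℤ) (q : ℂ) :
    quinticF n q = quarticForm (fun i => (quinticCoeff n i : ℂ)) (quinticBFive q)
      (quinticAFive q) := by
  rw [← quinticB_pow_five, ← quinticA_pow_five, quinticF, quarticForm]
  ring

theorem quinticCoeff_add_one (n : ℤ) :
    quinticCoeff (n + 1) = quinticMatrix *ᵥ quinticCoeff n := by
  have h : IsUnit quinticMatrix.det := by
    rw [quinticMatrix_det]
    norm_num
  rw [quinticCoeff, quinticCoeff, add_comm, Matrix.zpow_one_add h, Matrix.mulVec_mulVec]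

/-- The functional form of Ω_{5,0} F_n = F_{n+1}: q ↦ ζʲq fixes q⁵ and multiplies qθ₃(q⁵) by ζʲ. -/
theorem sum_fifth_roots_quinticF {z : ℂ} (hz : IsPrimitiveRoot z 5) (n : ℤ) {q : ℂ}
    (hq : ‖q‖ < 1) :
    ∑ j ∈ Finset.range 5, quinticF n (z ^ j * q) = 5 * quinticF (n + 1) (q ^ 5) := by
  have hz5 : ∀ j, (z ^ j * q) ^ 5 = q ^ 5 := fun j => by
    rw [mul_pow, ← pow_mul, mul_comm j 5, pow_mul, hz.pow_eq_one, one_pow, one_mul]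
  have hn : ∀ j, ‖z ^ j * q‖ < 1 := fun j => by
    rw [norm_mul, norm_pow, hz.norm'_eq_one (by norm_num), one_pow, one_mul]
    exact hq
  have hdiv : ∀ (v : Fin 5 → ℂ) (X Y e : ℂ), quarticForm v (X / e ^ 3) (Y / e ^ 3) =
      quarticForm v X Y / e ^ 12 := fun v X Y e => by
    simp only [quarticForm]
    ring
  have h : ∀ j, quinticF n (z ^ j * q) = quarticForm (fun i => (quinticCoeff n i : ℂ))
      (fifthRootFormB (quinticTheta 1 (q ^ 5)) (z ^ j * (q * quinticTheta 3 (q ^ 5))))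
      (fifthRootFormA (quinticTheta 1 (q ^ 5)) (z ^ j * (q * quinticTheta 3 (q ^ 5)))) /
        eulerProd (q ^ 5) ^ 12 := fun j => by
    obtain ⟨hB, hA⟩ := quintic_transformation (hn j)
    rw [hz5, mul_assoc] at hB hA
    rw [quinticF_eq_quarticForm, hB, hA, hdiv]
  simp_rw [h]
  rw [← Finset.sum_div, sum_fifth_roots_quarticForm hz, quinticF_eq_quarticForm, quinticBFive,
    quinticAFive, hdiv, mul_div_assoc, mul_pow q]
  congr 3
  funext i
  fin_cases i <;>
    simp [quinticCoeff_add_one, quinticMatrix, Matrix.mulVec, dotProduct, Fin.sum_univ_succ] <;>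
    ring

theorem differentiableOn_quinticF (n : ℤ) : DifferentiableOn ℂ (quinticF n) (Metric.ball 0 1) := by
  have h1 := differentiableOn_quinticBFive
  have h2 := differentiableOn_quinticAFive
  refine DifferentiableOn.congr ?_ fun q _ => quinticF_eq_quarticForm n q
  simp only [quarticForm]
  fun_prop

/-! ### Power series and multisection -/

theorem exists_hasQExpansion {f : ℂ → ℂ} (hf : DifferentiableOn ℂ f (Metric.ball 0 1)) :
    ∃ P : PowerSeries ℂ, HasQExpansion f P := by
  refine ⟨PowerSeries.mk fun k => (k.factorial : ℂ)⁻¹ * iteratedDeriv k f 0, fun q hq => ?_⟩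
  have := Complex.hasSum_taylorSeries_on_ball hf (z := q) (by simpa using hq)
  refine this.congr_fun ?_
  intro k
  simp only [PowerSeries.coeff_mk, smul_eq_mul, sub_zero]
  ring

/-- Summing over fifth roots of unity kills the coefficients with index prime to 5 and multiplies
the others by 5; every point of the disc is some q⁵. -/
theorem HasQExpansion.multisection_zero {f g : ℂ → ℂ} {P : PowerSeries ℂ} {z : ℂ}
    (hz : IsPrimitiveRoot z 5) (hf : HasQExpansion f P)
    (h : ∀ q : ℂ, ‖q‖ < 1 → ∑ j ∈ Finset.range 5, f (z ^ j * q) = 5 * g (q ^ 5)) :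
    HasQExpansion g (multisection 0 P) := by
  intro w hw
  obtain ⟨q, rfl⟩ : ∃ q : ℂ, q ^ 5 = w := IsAlgClosed.exists_pow_nat_eq w (by norm_num)
  have hq : ‖q‖ < 1 := by
    rw [norm_pow] at hw
    exact (pow_lt_one_iff_of_nonneg (norm_nonneg q) (by norm_num)).mp hw
  have hn : ∀ j, ‖z ^ j * q‖ < 1 := fun j => by
    rw [norm_mul, norm_pow, hz.norm'_eq_one (by norm_num), one_pow, one_mul]
    exact hq
  have h1 := hasSum_sum (s := Finset.range 5) fun j _ => hf (z ^ j * q) (hn j)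
  simp_rw [← Finset.mul_sum, sum_fifth_roots_pow hz] at h1
  rw [h q hq] at h1
  have hinj : Function.Injective fun k : ℕ => 5 * k := fun a b hab => by simpa using hab
  rw [← hinj.hasSum_iff] at h1
  · have h2 := h1.mul_left (1 / 5)
    rw [← mul_assoc, one_div_mul_cancel (by norm_num), one_mul] at h2
    convert! h2 using 1
    funext k
    simp only [multisection, PowerSeries.coeff_mk, Function.comp, dvd_mul_right, if_true, add_zero,
      pow_mul]
    ring
  · intro k hk
    have : ¬ 5 ∣ k := fun ⟨m, hm⟩ => hk ⟨m, hm.symm⟩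
    simp [this]

theorem HasQExpansion.quinticF_iterate {n : ℤ} {P : PowerSeries ℂ}
    (h : HasQExpansion (quinticF n) P) (m : ℕ) :
    HasQExpansion (quinticF (n + m)) ((multisection 0)^[m] P) := by
  induction m with
  | zero => simpa using h
  | succ m ih =>
    have hz := Complex.isPrimitiveRoot_exp 5 (by norm_num)
    rw [Function.iterate_succ_apply', Nat.cast_succ, ← add_assoc]
    exact ih.multisection_zero hz fun q hq => sum_fifth_roots_quinticF hz _ hq

theorem coeff_multisection_zero_iterate (P : PowerSeries ℂ) (n k : ℕ) :
    PowerSeries.coeff k ((multisection 0)^[n] P) = PowerSeries.coeff (5 ^ n * k) P := by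
  induction n generalizing k with
  | zero => simp
  | succ n ih =>
    rw [Function.iterate_succ_apply', multisection, PowerSeries.coeff_mk, ih, add_zero, pow_succ,
      mul_assoc]

/-- The power series of the Eisenstein series of weight four. -/
noncomputable def eisensteinFourSeries : PowerSeries ℂ :=
  PowerSeries.mk fun k => if k = 0 then 1 else 240 * ∑ d ∈ k.divisors, (d : ℂ) ^ 3

theorem quinticF_zero_eq {q : ℂ} (hq : ‖q‖ < 1) : quinticF 0 q = eisensteinFour q := by
  rw [← faceForm_eq_eisensteinFour hq, quinticF_eq_quarticForm, quarticForm, icosahedralFaceForm]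
  simp [quinticCoeff]
  ring

theorem hasQExpansion_quinticF_zero : HasQExpansion (quinticF 0) eisensteinFourSeries := by
  intro q hq
  rw [quinticF_zero_eq hq, ← hasSum_nat_add_iff' 1]
  have h := ((summable_eisensteinFour hq).hasSum).mul_left 240
  convert! h using 1
  · funext k
    simp [eisensteinFourSeries, mul_assoc]
  · simp [eisensteinFourSeries, eisensteinFour]

theorem corollary1p4 (n : ℕ) :
    (∀ q : ℂ, ‖q‖ < 1 →
      Summable (fun k : ℕ => (∑ d ∈ (5 ^ n * (k + 1)).divisors, (d : ℂ) ^ 3) * q ^ (k + 1)) ∧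
      1 + 240 * ∑' k : ℕ, (∑ d ∈ (5 ^ n * (k + 1)).divisors, (d : ℂ) ^ 3) * q ^ (k + 1) =
        quinticF n q) ∧
    (∃ P : PowerSeries ℂ, HasQExpansion (quinticF (-(n : ℤ))) P ∧
      HasQExpansion
        (fun q => 1 + 240 * ∑' k : ℕ, (∑ d ∈ (k + 1).divisors, (d : ℂ) ^ 3) * q ^ (k + 1))
        ((multisection 0)^[n] P)) := by
  refine ⟨fun q hq => ?_, ?_⟩
  · have h := hasQExpansion_quinticF_zero.quinticF_iterate n q hq
    -- The constant term is split off: it is 1 and does not follow the divisor-sum formula.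
    rw [zero_add, ← hasSum_nat_add_iff' 1] at h
    have h2 := h.mul_left (1 / 240)
    have h3 : HasSum (fun k : ℕ => (∑ d ∈ (5 ^ n * (k + 1)).divisors, (d : ℂ) ^ 3) * q ^ (k + 1))
        (1 / 240 * (quinticF n q - 1)) := by
      convert! h2 using 1
      · funext k
        rw [coeff_multisection_zero_iterate, eisensteinFourSeries, PowerSeries.coeff_mk,
          if_neg (by positivity)]
        ring
      · simp [coeff_multisection_zero_iterate, eisensteinFourSeries]
    refine ⟨h3.summable, ?_⟩
    rw [h3.tsum_eq]
    ring
  · obtain ⟨P, hP⟩ := exists_hasQExpansion (differentiableOn_quinticF (-(n : ℤ)))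
    refine ⟨P, hP, fun q hq => ?_⟩
    have h := hP.quinticF_iterate n q hq
    -- Starting from index -n, n multisections end at F₀.
    rw [neg_add_cancel, quinticF_zero_eq hq] at h
    exact h
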